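/- Let $\mathbb F_q$ be any finite field. A code is a linear subspace $C\subseteq\mathbb F_q^n$; its dual is $C^\perp=\{x\in\mathbb F_q^n : x\cdot y=0\ \forall y\in C\}$, where $x\cdot y=\sum_i x_iy_i$. For codes $C_1,C_2\subseteq\mathbb F_q^n$, let $C_1\otimes\mathbb F_q^n$ (resp. $\mathbb F_q^n\otimes C_2$) be the space of $n\times n$ matrices over $\mathbb F_q$ all of whose columns lie in $C_1$ (resp. all of whose rows lie in $C_2$). The pair $(C_1,C_2)$ is called $\rho$-product-expanding if every $x\in C_1\otimes\mathbb F_q^n+\mathbb F_q^n\otimes C_2$ can be written as $x=c+r$ with $c\in C_1\otimes\mathbb F_q^n$ and $r\in\mathbb F_q^n\otimes C_2$ such that $$|x|\ \ge\ \rho\, n\,\bigl(|c|_{\mathrm{col}}+|r|_{\mathrm{row}}\bigr),$$ where $|x|$ is the number of nonzero entries of $x$, $|c|_{\mathrm{col}}$ is the number of nonzero columns of $c$, and $|r|_{\mathrm{row}}$ is the number of nonzero rows of $r$. **Proposition.** Fix a finite field $\mathbb F_q$. For every $\epsilon>0$ there exist a constant $\rho>0$ and a function $\delta:\mathbb N\to\mathbb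 R$ with $\delta(n)\to0$ as $n\to\infty$ (both depending only on $q$ and $\epsilon$) such that the following holds. For every $n$ and every pair of integers $k_1,k_2\in(\epsilon n,(1-\epsilon)n)$, if $C_1,C_2\subseteq\mathbb F_q^n$ are drawn independently, $C_i$ uniformly at random from the set of linear codes of dimension $k_i$ that contain the all-ones vector $\mathbf 1\in\mathbb F_q^n$, then with probability at least $1-\delta(n)$ both $(C_1,C_2^\perp)$ and $(C_1^\perp,C_2)$ are $\rho$-product-expanding. -/

import Mathlib

open MeasureTheory ProbabilityTheory Filter Topology

/-- The dual code `C^⊥ = {x : x · y = 0 for all y ∈ C}` with respect to the standard bilinear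
dot product. -/
def dualCode {F : Type*} [Field F] {ι : Type*} [Fintype ι] (C : Submodule F (ι → F)) :
    Submodule F (ι → F) where
  carrier := {x | ∀ y ∈ C, x ⬝ᵥ y = 0}
  add_mem' := by
    intro a b ha hb y hy
    rw [add_dotProduct, ha y hy, hb y hy, add_zero]
  zero_mem' := by
    intro y _
    exact zero_dotProduct y
  smul_mem' := by
    intro c x hx y hy
    rw [smul_dotProduct, hx y hy, smul_zero]

/-- The tensor code `C₁ ⊗ C₂`: matrices all of whose columns lie in `C₁` and all of whose rows
lie in `C₂`. -/
def tensorCode {F : Type*} [Field F] {ι κ : Type*} (C₁ : Submodule F (ι → F))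
    (C₂ : Submodule F (κ → F)) : Submodule F (Matrix ι κ F) where
  carrier := {x | (∀ j, (fun i => x i j) ∈ C₁) ∧ ∀ i, (fun j => x i j) ∈ C₂}
  add_mem' := by
    rintro a b ⟨ha, ha'⟩ ⟨hb, hb'⟩
    exact ⟨fun j => C₁.add_mem (ha j) (hb j), fun i => C₂.add_mem (ha' i) (hb' i)⟩
  zero_mem' := ⟨fun _ => C₁.zero_mem, fun _ => C₂.zero_mem⟩
  smul_mem' := by
    rintro c x ⟨hx, hx'⟩
    exact ⟨fun j => C₁.smul_mem c (hx j), fun i => C₂.smul_mem c (hx' i)⟩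

/-- The Hamming weight `|x|` of a matrix: its number of nonzero entries. -/
noncomputable def matrixWeight {F : Type*} [Zero F] {ι κ : Type*} (x : Matrix ι κ F) : ℕ :=
  {p : ι × κ | x p.1 p.2 ≠ 0}.ncard

/-- The number of nonzero columns of a matrix. -/
noncomputable def colWeight {F : Type*} [Zero F] {ι κ : Type*} (x : Matrix ι κ F) : ℕ :=
  {j : κ | ∃ i, x i j ≠ 0}.ncard

/-- The number of nonzero rows of a matrix. -/
noncomputable def rowWeight {F : Type*} [Zero F] {ι κ : Type*} (x : Matrix ι κ F) : ℕ :=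
  {i : ι | ∃ j, x i j ≠ 0}.ncard

/-- `(C₁, C₂)` is `ρ`-product-expanding: every `x ∈ C₁ ⊗ F^n + F^n ⊗ C₂` can be written as
`x = c + r` with `c ∈ C₁ ⊗ F^n`, `r ∈ F^n ⊗ C₂` and `|x| ≥ ρ n (|c|_col + |r|_row)`. -/
def IsProductExpanding {F : Type*} [Field F] {n : ℕ} (ρ : ℝ)
    (C₁ C₂ : Submodule F (Fin n → F)) : Prop :=
  ∀ x ∈ tensorCode C₁ (⊤ : Submodule F (Fin n → F)) ⊔
      tensorCode (⊤ : Submodule F (Fin n → F)) C₂,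
    ∃ c ∈ tensorCode C₁ (⊤ : Submodule F (Fin n → F)),
      ∃ r ∈ tensorCode (⊤ : Submodule F (Fin n → F)) C₂,
        x = c + r ∧
          ρ * (n : ℝ) * ((colWeight c : ℝ) + (rowWeight r : ℝ)) ≤ (matrixWeight x : ℝ)

/-- The set of linear codes of block length `n` and dimension `k` that contain the all-ones
vector. -/
def plantedCodes (F : Type*) [Field F] (n k : ℕ) : Set (Submodule F (Fin n → F)) :=
  {C | Module.finrank F C = k ∧ (1 : Fin n → F) ∈ C}

/-- Codes of block length `n` over `F` carry the discrete `σ`-algebra. -/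
instance codeMeasurableSpace {F : Type*} [Field F] {n : ℕ} :
    MeasurableSpace (Submodule F (Fin n → F)) := ⊤

/-!
A random code `D` of either kind (a random code containing `𝟏`, or the dual of one) contains a
given space `T` of dimension at least two with probability at most `p ^ dim T`, where `p` is
exponentially small in `n`. Only tests of dimension at least two are available, since `𝟏` itself
lies in every code of the first kind.

Let `x = c + r` be a matrix of the sum code with few nonzero entries. Combining the rows of `x` with
coefficients in `C₁^⊥` kills `c`, so the resulting space of vectors, together with the part of the
column space of `x` inside `C₁`, exhausts the rank of `x`. For a matrix of rank linear in `n` one of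
the two is large, which has probability `q ^ (-Ω(n²))`; the union bound over all matrices of weight
at most `η n²` then leaves only matrices of small rank.

If `x` has small rank, erase its heavy rows and columns. The remaining matrix has row and column
spaces spanned by light vectors, and by the same identity one of them meets its code, enlarged by
the vectors supported on the erased coordinates, in at least half of its dimension. Random codes
are robust against such intersections, so the remaining matrix vanishes: `x` is supported on few
rows and columns, and projecting onto the codes along the erased coordinates gives a decomposition
supported on exactly these rows and columns.
-/

section SubspaceCounting

open Module Submodule

variable {F V : Type*} [Field F] [AddCommGroup V] [Module F V]

/-- The subspaces of dimension `d` that lie between `T` and `S`. -/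
def subspacesBetween (d : ℕ) (T S : Submodule F V) : Set (Submodule F V) :=
  {D | finrank F D = d ∧ T ≤ D ∧ D ≤ S}

theorem mem_subspacesBetween_sup_span {d : ℕ} {T S D : Submodule F V} {v : V} :
    D ∈ subspacesBetween d (T ⊔ span F {v}) S ↔ D ∈ subspacesBetween d T S ∧ v ∈ D := by
  simp only [subspacesBetween, Set.mem_ofPred_eq, sup_le_iff, span_singleton_le_iff_mem]
  tauto

theorem image_map_subspacesBetween (d : ℕ) (T S : Submodule F V) (e : V ≃ₗ[F] V) :
    Submodule.map e.toLinearMap '' subspacesBetween d T S =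
      subspacesBetween d (T.map e.toLinearMap) (S.map e.toLinearMap) := by
  ext D
  constructor
  · rintro ⟨D, ⟨hd, hT, hS⟩, rfl⟩
    exact ⟨(e.finrank_map_eq D).trans hd, map_mono hT, map_mono hS⟩
  · rintro ⟨hd, hT, hS⟩
    have hD : (D.comap e.toLinearMap).map e.toLinearMap = D :=
      map_comap_eq_of_surjective e.surjective D
    refine ⟨D.comap e.toLinearMap, ⟨?_, map_le_iff_le_comap.1 hT, ?_⟩, hD⟩
    · rw [← hd, ← e.finrank_map_eq, hD]
    · exact (map_le_map_iff_of_injective e.injective _ _).1 (hD.le.trans hS)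

theorem exists_le_ker_apply_ne_zero_apply_ne_zero {T : Submodule F V} {v v' : V}
    (hv : v ∉ T) (hv' : v' ∉ T) :
    ∃ f : Dual F V, T ≤ LinearMap.ker f ∧ f v ≠ 0 ∧ f v' ≠ 0 := by
  obtain ⟨f, hfv, hfT⟩ := exists_le_ker_of_notMem hv
  obtain ⟨g, hgv', hgT⟩ := exists_le_ker_of_notMem hv'
  by_cases hfv' : f v' = 0
  · by_cases hgv : g v = 0
    · refine ⟨f + g, fun x hx => ?_, by simpa [hgv] using hfv, by simpa [hfv'] using hgv'⟩
      rw [LinearMap.mem_ker, LinearMap.add_apply, LinearMap.mem_ker.1 (hfT hx),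
        LinearMap.mem_ker.1 (hgT hx), add_zero]
    · exact ⟨g, hgT, hgv, hgv'⟩
  · exact ⟨f, hfT, hfv, hfv'⟩

variable [Module.Finite F V]

theorem map_linearEquiv_eq_of_le {T : Submodule F V} {e : V ≃ₗ[F] V}
    (h : T.map e.toLinearMap ≤ T) : T.map e.toLinearMap = T :=
  eq_of_le_of_finrank_eq h (e.finrank_map_eq T)

theorem exists_linearEquiv_map_eq_map_eq_apply_eq {S T : Submodule F V} {v v' : V}
    (hvS : v ∈ S) (hv'S : v' ∈ S) (hvT : v ∉ T) (hv'T : v' ∉ T) :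
    ∃ e : V ≃ₗ[F] V, T.map e.toLinearMap = T ∧ S.map e.toLinearMap = S ∧ e v = v' := by
  obtain ⟨f, hfT, hfv, hfv'⟩ := exists_le_ker_apply_ne_zero_apply_ne_zero hvT hv'T
  have hunit : IsUnit (1 + ((f v)⁻¹ • f) (v' - v)) := by
    have : 1 + ((f v)⁻¹ • f) (v' - v) = (f v)⁻¹ * f v' := by
      rw [LinearMap.smul_apply, map_sub, smul_eq_mul, mul_sub, inv_mul_cancel₀ hfv, add_sub_cancel]
    rw [this, isUnit_iff_ne_zero]
    exact mul_ne_zero (inv_ne_zero hfv) hfv'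
  let e := LinearEquiv.dilatransvection hunit
  have he (x : V) : e x = x + ((f v)⁻¹ * f x) • (v' - v) := LinearEquiv.dilatransvection.apply
  refine ⟨e, map_linearEquiv_eq_of_le ?_, map_linearEquiv_eq_of_le ?_, ?_⟩
  · rintro _ ⟨x, hx, rfl⟩
    simpa [he, LinearMap.mem_ker.1 (hfT hx)] using hx
  · rintro _ ⟨x, hx, rfl⟩
    simpa [he] using S.add_mem hx (S.smul_mem _ (S.sub_mem hv'S hvS))
  · simp [he, hfv]

theorem ncard_subspacesBetween_sup_span_eq {d : ℕ} {T S : Submodule F V} {v v' : V}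
    (hvS : v ∈ S) (hv'S : v' ∈ S) (hvT : v ∉ T) (hv'T : v' ∉ T) :
    (subspacesBetween d (T ⊔ span F {v}) S).ncard =
      (subspacesBetween d (T ⊔ span F {v'}) S).ncard := by
  obtain ⟨e, heT, heS, hev⟩ := exists_linearEquiv_map_eq_map_eq_apply_eq hvS hv'S hvT hv'T
  rw [← Set.ncard_image_of_injective (subspacesBetween d (T ⊔ span F {v}) S)
      (map_injective_of_injective e.injective), image_map_subspacesBetween, Submodule.map_sup,
    Submodule.map_span, Set.image_singleton, heT, heS, LinearEquiv.coe_coe, hev]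

variable [Finite F]

theorem ncard_coe_sdiff_coe {T D : Submodule F V} (h : T ≤ D) :
    ((D : Set V) \ T).ncard = Nat.card F ^ finrank F D - Nat.card F ^ finrank F T := by
  have : Finite V := Module.finite_of_finite F
  rw [Set.ncard_sdiff h, ← Nat.card_coe_set_eq, ← Nat.card_coe_set_eq]
  exact congrArg₂ _ (Module.natCard_eq_pow_finrank (K := F))
    (Module.natCard_eq_pow_finrank (K := F))

theorem ncard_subspacesBetween_sup_span_mul {d : ℕ} {T S : Submodule F V} (hTS : T ≤ S) {v : V}
    (hvS : v ∈ S) (hvT : v ∉ T) :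
    (subspacesBetween d (T ⊔ span F {v}) S).ncard *
        (Nat.card F ^ finrank F S - Nat.card F ^ finrank F T) =
      (subspacesBetween d T S).ncard * (Nat.card F ^ d - Nat.card F ^ finrank F T) := by
  classical
  have : Finite V := Module.finite_of_finite F
  have := Fintype.ofFinite V
  have := Fintype.ofFinite (Submodule F V)
  have hcount := Finset.card_mul_eq_card_mul
    (s := ((S : Set V) \ T).toFinset) (t := (subspacesBetween d T S).toFinset)
    (fun (u : V) (D : Submodule F V) => u ∈ D)
    (m := (subspacesBetween d (T ⊔ span F {v}) S).ncard)
    (n := Nat.card F ^ d - Nat.card F ^ finrank F T) ?_ ?_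
  · rwa [← Set.ncard_eq_toFinset_card', ← Set.ncard_eq_toFinset_card', ncard_coe_sdiff_coe hTS,
      mul_comm] at hcount
  · intro u hu
    obtain ⟨huS, huT⟩ := Set.mem_toFinset.1 hu
    rw [ncard_subspacesBetween_sup_span_eq hvS huS hvT huT, Set.ncard_eq_toFinset_card']
    congr 1
    ext D
    simp only [Finset.mem_bipartiteAbove, Set.mem_toFinset, mem_subspacesBetween_sup_span]
  · intro D hD
    obtain ⟨rfl, hTD, hDS⟩ := Set.mem_toFinset.1 hD
    rw [← ncard_coe_sdiff_coe hTD, Set.ncard_eq_toFinset_card']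
    congr 1
    ext u
    simp only [Finset.mem_bipartiteBelow, Set.mem_toFinset, Set.mem_sdiff, SetLike.mem_coe]
    exact ⟨fun h => ⟨h.2, h.1.2⟩, fun h => ⟨⟨hDS h.1, h.2⟩, h.1⟩⟩

theorem ncard_subspacesBetween_sup_span_mul_pow_le {d : ℕ} {T S : Submodule F V}
    (hd : d ≤ finrank F S) (hTS : T ≤ S) {v : V} (hvS : v ∈ S) (hvT : v ∉ T) :
    (subspacesBetween d (T ⊔ span F {v}) S).ncard * Nat.card F ^ (finrank F S - d) ≤
      (subspacesBetween d T S).ncard := by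
  have hlt : Nat.card F ^ finrank F T < Nat.card F ^ finrank F S :=
    Nat.pow_lt_pow_right Finite.one_lt_card
      (finrank_lt_finrank_of_lt (lt_of_le_of_ne hTS fun h => hvT (h ▸ hvS)))
  refine Nat.le_of_mul_le_mul_right ?_ (Nat.sub_pos_of_lt hlt)
  rw [mul_right_comm, ncard_subspacesBetween_sup_span_mul hTS hvS hvT, mul_assoc]
  refine Nat.mul_le_mul_left _ ?_
  rw [Nat.sub_mul, ← pow_add, Nat.add_sub_cancel' hd]
  exact Nat.sub_le_sub_left (Nat.le_mul_of_pos_right _ (pow_pos Finite.card_pos _)) _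

theorem ncard_subspacesBetween_mul_pow_le {d : ℕ} {S : Submodule F V} (hd : d ≤ finrank F S)
    {T T' : Submodule F V} (hTT' : T ≤ T') (hT'S : T' ≤ S) :
    (subspacesBetween d T' S).ncard *
        (Nat.card F ^ (finrank F S - d)) ^ (finrank F T' - finrank F T) ≤
      (subspacesBetween d T S).ncard := by
  induction hr : finrank F T' - finrank F T generalizing T with
  | zero =>
    have : T = T' := eq_of_le_of_finrank_le hTT' (Nat.sub_eq_zero_iff_le.1 hr)
    simp [this]
  | succ r ih =>
    obtain ⟨v, hvT', hvT⟩ := SetLike.exists_of_lt (hTT'.lt_of_ne (by rintro rfl; simp at hr))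
    have hle : T ⊔ span F {v} ≤ T' := sup_le hTT' ((span_singleton_le_iff_mem _ _).2 hvT')
    have hr' : finrank F T' - finrank F ↥(T ⊔ span F {v}) = r := by
      rw [finrank_sup_span_singleton hvT]
      omega
    rw [pow_succ, ← mul_assoc]
    exact (Nat.mul_le_mul_right _ (ih hle hr')).trans
      (ncard_subspacesBetween_sup_span_mul_pow_le hd (hTT'.trans hT'S) (hT'S hvT') hvT)

theorem ncard_subspacesBetween_bot_le (t : ℕ) (E : Submodule F V) :
    (subspacesBetween t ⊥ E).ncard ≤ (Nat.card F ^ finrank F E) ^ t := by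
  have : Finite V := Module.finite_of_finite F
  let spanTuple (v : Fin t → E) : Submodule F V := span F (Set.range fun i => (v i : V))
  have hsurj : subspacesBetween t ⊥ E ⊆ Set.range spanTuple := by
    rintro T ⟨rfl, -, hTE⟩
    refine ⟨fun i => ⟨finBasis F T i, hTE (finBasis F T i).2⟩, ?_⟩
    calc span F (Set.range fun i => (finBasis F T i : V))
        = (span F (Set.range (finBasis F T))).map T.subtype := by
          rw [Submodule.map_span, ← Set.range_comp]; rfl
      _ = T := by rw [Basis.span_eq, map_subtype_top]
  calc (subspacesBetween t ⊥ E).ncard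
      ≤ (Set.range spanTuple).ncard := Set.ncard_le_ncard hsurj
    _ ≤ Nat.card (Fin t → E) := by
        rw [← Nat.card_coe_set_eq]; exact Finite.card_range_le _
    _ = (Nat.card F ^ finrank F E) ^ t := by
        rw [Nat.card_fun, Nat.card_fin, Module.natCard_eq_pow_finrank (K := F)]

end SubspaceCounting

section UniformSubspace

open Module Submodule

theorem measureReal_uniformOn {Ω : Type*} [Finite Ω] [MeasurableSpace Ω]
    [DiscreteMeasurableSpace Ω] (s t : Set Ω) :
    (uniformOn s).real t = ((s ∩ t).ncard : ℝ) / s.ncard := by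
  classical
  have := Fintype.ofFinite Ω
  have h := uniformOn_apply_finset (s := s.toFinset) (t := t.toFinset)
  rw [Set.coe_toFinset, Set.coe_toFinset] at h
  rw [Measure.real, h, ENNReal.toReal_div, ENNReal.toReal_natCast, ENNReal.toReal_natCast,
    ← Set.toFinset_inter, ← Set.ncard_eq_toFinset_card', ← Set.ncard_eq_toFinset_card']

theorem measureReal_uniformOn_preimage {Ω Ω' : Type*} [Finite Ω] [MeasurableSpace Ω]
    [DiscreteMeasurableSpace Ω] [Finite Ω'] [MeasurableSpace Ω'] [DiscreteMeasurableSpace Ω']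
    {f : Ω → Ω'} (hf : f.Injective) (s : Set Ω) (t : Set Ω') :
    (uniformOn s).real (f ⁻¹' t) = (uniformOn (f '' s)).real t := by
  rw [measureReal_uniformOn, measureReal_uniformOn, Set.ncard_image_of_injective s hf,
    ← Set.image_inter_preimage, Set.ncard_image_of_injective _ hf]

theorem measureReal_uniformOn_subspacesBetween_le {F V : Type*} [Field F] [Finite F]
    [AddCommGroup V] [Module F V] [Module.Finite F V] [MeasurableSpace (Submodule F V)]
    [DiscreteMeasurableSpace (Submodule F V)] {d : ℕ} {S : Submodule F V} (hd : d ≤ finrank F S)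
    (T T' : Submodule F V) :
    (uniformOn (subspacesBetween d T S)).real {D | T' ≤ D} ≤
      ((Nat.card F : ℝ) ^ (-(finrank F S - d : ℝ))) ^ (finrank F ↥(T ⊔ T') - finrank F T) := by
  have : Finite V := Module.finite_of_finite F
  have hinter : subspacesBetween d T S ∩ {D | T' ≤ D} = subspacesBetween d (T ⊔ T') S := by
    ext D
    simp only [subspacesBetween, Set.mem_inter_iff, Set.mem_ofPred_eq, sup_le_iff]
    tauto
  have hq : (0 : ℝ) < Nat.card F := by exact_mod_cast Finite.card_pos
  rw [measureReal_uniformOn, hinter, Real.rpow_neg hq.le, ← Nat.cast_sub hd, Real.rpow_natCast,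
    inv_pow]
  by_cases hS : T ⊔ T' ≤ S
  · have hcount := ncard_subspacesBetween_mul_pow_le hd (le_sup_left : T ≤ T ⊔ T') hS
    refine div_le_of_le_mul₀ (Nat.cast_nonneg _) (by positivity) ?_
    rw [inv_mul_eq_div, le_div_iff₀ (by positivity)]
    exact_mod_cast hcount
  · have hempty : subspacesBetween d (T ⊔ T') S = ∅ :=
      Set.eq_empty_of_forall_notMem fun D hD => hS (hD.2.1.trans hD.2.2)
    rw [hempty, Set.ncard_empty, Nat.cast_zero, zero_div]
    positivity

end UniformSubspace

section Duality

open Module Submodule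

variable {F ι : Type*} [Field F] [Fintype ι]

theorem mem_dualCode {C : Submodule F (ι → F)} {x : ι → F} :
    x ∈ dualCode C ↔ ∀ y ∈ C, x ⬝ᵥ y = 0 := Iff.rfl

theorem le_dualCode_comm {C D : Submodule F (ι → F)} : C ≤ dualCode D ↔ D ≤ dualCode C := by
  constructor <;> intro h x hx y hy <;> rw [dotProduct_comm] <;> exact h hy x hx

theorem dualCode_eq_orthogonal (C : Submodule F (ι → F)) :
    dualCode C = LinearMap.BilinForm.orthogonal (dotProductBilin F F) C := by
  ext x
  rw [mem_dualCode, LinearMap.BilinForm.mem_orthogonal_iff]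
  refine forall₂_congr fun y _ => ?_
  rw [dotProduct_comm]
  rfl

theorem nondegenerate_dotProductBilin :
    LinearMap.BilinForm.Nondegenerate (dotProductBilin F F : LinearMap.BilinForm F (ι → F)) :=
  ⟨fun x hx => dotProduct_eq_zero x hx, fun x hx => dotProduct_eq_zero x fun y => by
    rw [dotProduct_comm]; exact hx y⟩

theorem finrank_dualCode (C : Submodule F (ι → F)) :
    finrank F (dualCode C) = Fintype.card ι - finrank F C := by
  rw [dualCode_eq_orthogonal, LinearMap.BilinForm.finrank_orthogonal nondegenerate_dotProductBilin,
    finrank_pi]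

theorem dualCode_dualCode (C : Submodule F (ι → F)) : dualCode (dualCode C) = C := by
  simp_rw [dualCode_eq_orthogonal]
  exact LinearMap.BilinForm.orthogonal_orthogonal nondegenerate_dotProductBilin
    (fun x y h => (dotProduct_comm y x).trans h) C

theorem dualCode_injective :
    Function.Injective (dualCode : Submodule F (ι → F) → Submodule F (ι → F)) :=
  Function.LeftInverse.injective dualCode_dualCode

theorem dualCode_le_dualCode {C D : Submodule F (ι → F)} : dualCode C ≤ dualCode D ↔ D ≤ C := by
  rw [le_dualCode_comm, dualCode_dualCode]

theorem dualCode_top : dualCode (⊤ : Submodule F (ι → F)) = ⊥ :=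
  eq_bot_iff.2 fun x hx => dotProduct_eq_zero x fun y => hx y mem_top

theorem image_dualCode_subspacesBetween {d : ℕ} (hd : d ≤ Fintype.card ι)
    (T S : Submodule F (ι → F)) :
    dualCode '' subspacesBetween d T S =
      subspacesBetween (Fintype.card ι - d) (dualCode S) (dualCode T) := by
  ext D
  constructor
  · rintro ⟨C, ⟨rfl, hTC, hCS⟩, rfl⟩
    exact ⟨finrank_dualCode C, dualCode_le_dualCode.2 hCS, dualCode_le_dualCode.2 hTC⟩
  · rintro ⟨hDd, hSD, hDT⟩
    refine ⟨dualCode D, ⟨?_, le_dualCode_comm.1 hDT, ?_⟩, dualCode_dualCode D⟩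
    · rw [finrank_dualCode, hDd, Nat.sub_sub_self hd]
    · rwa [← dualCode_le_dualCode, dualCode_dualCode]

end Duality

section Spread

open Module Submodule

variable {F : Type*} [Field F]

/-- A random subspace `D` of `V` is spread with parameter `p`, up to the vector `u`, if it contains
each fixed subspace `T` with probability at most `p ^ dim T`. The line through `u` is exempted, as
the random codes of interest all contain the all-ones vector. -/
def IsSpread {V Ω : Type*} [AddCommGroup V] [Module F V] [MeasurableSpace Ω] (μ : Measure Ω)
    (D : Ω → Submodule F V) (u : V) (p : ℝ) : Prop :=
  ∀ T : Submodule F V, T ≠ span F {u} → μ.real {ω | T ≤ D ω} ≤ p ^ finrank F T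

theorem IsSpread.mono {V Ω : Type*} [AddCommGroup V] [Module F V] [MeasurableSpace Ω]
    {μ : Measure Ω} {D : Ω → Submodule F V} {u : V} {p p' : ℝ} (hD : IsSpread μ D u p)
    (hp : 0 ≤ p) (hpp' : p ≤ p') : IsSpread μ D u p' :=
  fun T hT => (hD T hT).trans (pow_le_pow_left₀ hp hpp' _)

instance {n : ℕ} : DiscreteMeasurableSpace (Submodule F (Fin n → F)) := ⟨fun _ => trivial⟩

theorem plantedCodes_eq_subspacesBetween (n k : ℕ) :
    plantedCodes F n k = subspacesBetween k (span F {1}) ⊤ := by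
  ext C
  simp only [plantedCodes, subspacesBetween, span_singleton_le_iff_mem, le_top, and_true]

theorem plantedCodes_nonempty {n k : ℕ} (hk : 0 < k) (hkn : k ≤ n) :
    (plantedCodes F n k).Nonempty := by
  induction k, hk using Nat.le_induction with
  | base =>
    have : NeZero n := ⟨by omega⟩
    exact ⟨span F {1}, finrank_span_singleton one_ne_zero, mem_span_singleton_self _⟩
  | succ k _ ih =>
    obtain ⟨C, hCk, hC1⟩ := ih (by omega)
    obtain ⟨v, hv⟩ : ∃ v, v ∉ C := by
      by_contra! hC
      rw [eq_top_iff'.2 hC, finrank_top, finrank_pi, Fintype.card_fin] at hCk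
      omega
    exact ⟨C ⊔ span F {v}, by rw [finrank_sup_span_singleton hv, hCk], mem_sup_left hC1⟩

theorem finrank_le_two_mul_finrank_span_sup_sub {V : Type*} [AddCommGroup V] [Module F V]
    [Module.Finite F V] {T : Submodule F V} {u : V} (hT : T ≠ span F {u}) :
    finrank F T ≤ 2 * (finrank F ↥(span F {u} ⊔ T) - finrank F (span F {u})) := by
  have hspan : finrank F (span F {u}) ≤ 1 := finrank_span_le_card {u}
  by_cases hu : u ∈ T
  · have hle : span F {u} ≤ T := (span_singleton_le_iff_mem _ _).2 hu
    have hlt : finrank F (span F {u}) < finrank F T :=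
      finrank_lt_finrank_of_lt (hle.lt_of_ne hT.symm)
    rw [sup_eq_right.2 hle]
    omega
  · rw [sup_comm, finrank_sup_span_singleton hu]
    omega

variable [Finite F] {n k : ℕ}

theorem isSpread_plantedCodes (hkn : k ≤ n) :
    IsSpread (uniformOn (plantedCodes F n k)) id 1
      ((Nat.card F : ℝ) ^ (-((n - k) / 2 : ℝ))) := by
  intro T hT
  have hq : (1 : ℝ) ≤ Nat.card F := by exact_mod_cast Finite.card_pos
  have hkn' : (0 : ℝ) ≤ (n - k) / 2 := by
    have : (k : ℝ) ≤ n := by exact_mod_cast hkn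
    linarith
  have h := measureReal_uniformOn_subspacesBetween_le (F := F) (V := Fin n → F) (d := k)
    (S := ⊤) (by simpa using hkn) (span F {1}) T
  rw [finrank_top, finrank_pi, Fintype.card_fin,
    show -(n - k : ℝ) = -((n - k) / 2) * (2 : ℕ) by push_cast; ring, Real.rpow_mul_natCast
      (by positivity), ← pow_mul, ← plantedCodes_eq_subspacesBetween] at h
  exact h.trans (pow_le_pow_of_le_one (by positivity)
    (Real.rpow_le_one_of_one_le_of_nonpos hq (by linarith))
    (finrank_le_two_mul_finrank_span_sup_sub hT))

theorem isSpread_dualCode_plantedCodes (hk : 0 < k) (hkn : k ≤ n) :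
    IsSpread (uniformOn (plantedCodes F n k)) dualCode 1
      ((Nat.card F : ℝ) ^ (-(k - 1 : ℝ))) := by
  intro T _
  have : NeZero n := ⟨by omega⟩
  have hdim : finrank F (dualCode (span F {(1 : Fin n → F)})) = n - 1 := by
    rw [finrank_dualCode, Fintype.card_fin, finrank_span_singleton one_ne_zero]
  have himage : dualCode '' plantedCodes F n k =
      subspacesBetween (n - k) ⊥ (dualCode (span F {1})) := by
    rw [plantedCodes_eq_subspacesBetween, image_dualCode_subspacesBetween (by simpa using hkn),
      Fintype.card_fin, dualCode_top]
  have h := measureReal_uniformOn_subspacesBetween_le (d := n - k)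
    (S := dualCode (span F {(1 : Fin n → F)})) (by rw [hdim]; omega) ⊥ T
  rw [← himage, ← measureReal_uniformOn_preimage dualCode_injective, hdim, bot_sup_eq, finrank_bot,
    Nat.sub_zero, Nat.cast_sub hkn, Nat.cast_sub (by omega : 1 ≤ n), Nat.cast_one] at h
  rwa [show (n - 1 - (n - k) : ℝ) = k - 1 by ring] at h

end Spread

section UnionBound

open Module Submodule

variable {Ω : Type*} [MeasurableSpace Ω] {μ : Measure Ω}

theorem measureReal_setOf_exists_le {α : Type*} [Finite α] {P : α → Ω → Prop} {b : ℝ}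
    (h : ∀ a, μ.real {ω | P a ω} ≤ b) : μ.real {ω | ∃ a, P a ω} ≤ Nat.card α * b := by
  have := Fintype.ofFinite α
  calc μ.real {ω | ∃ a, P a ω}
      = μ.real (⋃ a ∈ Finset.univ, {ω | P a ω}) := by
        congr 1
        ext ω
        simp
    _ ≤ ∑ a, μ.real {ω | P a ω} := measureReal_biUnion_finset_le _ _
    _ ≤ Nat.card α * b := by
        rw [Nat.card_eq_fintype_card, ← Finset.card_univ, ← nsmul_eq_mul]
        exact Finset.sum_le_card_nsmul _ _ _ fun a _ => h a

variable {F V : Type*} [Field F] [AddCommGroup V] [Module F V]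

theorem exists_le_finrank_eq {T : Submodule F V} {t : ℕ} (ht : t ≤ finrank F T) :
    ∃ T' ≤ T, finrank F T' = t := by
  obtain ⟨v, hv⟩ := exists_linearIndependent_of_le_finrank ht
  refine ⟨(span F (Set.range v)).map T.subtype, map_subtype_le _ _, ?_⟩
  rw [finrank_map_subtype_eq, finrank_span_eq_card hv, Fintype.card_fin]

theorem ne_span_singleton_of_two_le_finrank {T : Submodule F V} (hT : 2 ≤ finrank F T) (u : V) :
    T ≠ span F {u} := by
  rintro rfl
  have := finrank_span_le_card (R := F) ({u} : Set V)
  simp at this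
  omega

variable [IsFiniteMeasure μ] {D : Ω → Submodule F V} {u : V} {p : ℝ}

theorem IsSpread.measureReal_le_pow (hD : IsSpread μ D u p) {T : Submodule F V} {t : ℕ}
    (ht : 2 ≤ t) (htT : t ≤ finrank F T) : μ.real {ω | T ≤ D ω} ≤ p ^ t := by
  obtain ⟨T', hT'T, rfl⟩ := exists_le_finrank_eq htT
  exact (measureReal_mono fun ω hω => hT'T.trans hω).trans
    (hD T' (ne_span_singleton_of_two_le_finrank ht u))

theorem IsSpread.measureReal_le_finrank_inf_le [Finite F] [Module.Finite F V] (hp : 0 ≤ p)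
    (hD : IsSpread μ D u p) {E : Submodule F V} {t : ℕ} (hu : 2 ≤ t ∨ u ∉ E) :
    μ.real {ω | t ≤ finrank F ↥(D ω ⊓ E)} ≤ ((Nat.card F : ℝ) ^ finrank F E * p) ^ t := by
  have : Finite V := Module.finite_of_finite F
  have hsub : {ω | t ≤ finrank F ↥(D ω ⊓ E)} ⊆
      {ω | ∃ T : subspacesBetween t ⊥ E, T ≤ D ω} := fun ω hω => by
    obtain ⟨T, hT, hTt⟩ := exists_le_finrank_eq hω
    exact ⟨⟨T, hTt, bot_le, hT.trans inf_le_right⟩, hT.trans inf_le_left⟩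
  have hcontain (T : subspacesBetween t ⊥ E) : μ.real {ω | T ≤ D ω} ≤ p ^ t := by
    obtain ⟨T, rfl, -, hTE⟩ := T
    refine hD T ?_
    rcases hu with ht | hu
    · exact ne_span_singleton_of_two_le_finrank ht u
    · rintro rfl
      exact hu (hTE (mem_span_singleton_self u))
  calc μ.real {ω | t ≤ finrank F ↥(D ω ⊓ E)}
      ≤ Nat.card (subspacesBetween t ⊥ E) * p ^ t :=
        (measureReal_mono hsub).trans (measureReal_setOf_exists_le hcontain)
    _ ≤ ((Nat.card F : ℝ) ^ finrank F E) ^ t * p ^ t := by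
        gcongr
        rw [Nat.card_coe_set_eq]
        exact_mod_cast ncard_subspacesBetween_bot_le t E
    _ = ((Nat.card F : ℝ) ^ finrank F E * p) ^ t := (mul_pow _ _ _).symm

end UnionBound

section HammingWeight

open Module Submodule

variable {F ι : Type*} [Field F]

/-- The vectors whose support lies in `A`. -/
def supportedOn (F : Type*) [Field F] {ι : Type*} (A : Finset ι) : Submodule F (ι → F) where
  carrier := {v | ∀ i, i ∉ A → v i = 0}
  add_mem' := fun ha hb i hi => by simp [ha i hi, hb i hi]
  zero_mem' := fun _ _ => rfl
  smul_mem' := fun c _ ha i hi => by simp [ha i hi]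

theorem mem_supportedOn {A : Finset ι} {v : ι → F} :
    v ∈ supportedOn F A ↔ ∀ i, i ∉ A → v i = 0 := Iff.rfl

theorem finrank_supportedOn_le (A : Finset ι) : finrank F (supportedOn F A) ≤ A.card := by
  have h := LinearMap.finrank_le_finrank_of_injective
    (f := LinearMap.funLeft F F ((↑) : A → ι) ∘ₗ (supportedOn F A).subtype) fun v w hvw => by
      ext i
      by_cases hi : i ∈ A
      · exact congrFun hvw ⟨i, hi⟩
      · rw [mem_supportedOn.1 v.2 i hi, mem_supportedOn.1 w.2 i hi]
  simpa using h

variable [Fintype ι] [DecidableEq F]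

theorem hammingNorm_le_of_mem_supportedOn {A : Finset ι} {v : ι → F} (hv : v ∈ supportedOn F A) :
    hammingNorm v ≤ A.card :=
  Finset.card_le_card fun i hi => by
    by_contra hiA
    exact (Finset.mem_filter.1 hi).2 (hv i hiA)

theorem hammingNorm_add_le (v w : ι → F) :
    hammingNorm (v + w) ≤ hammingNorm v + hammingNorm w := by
  simpa [hammingDist_eq_hammingNorm] using hammingDist_triangle (-v) 0 w

theorem hammingNorm_sum_le {κ : Type*} (s : Finset κ) (v : κ → ι → F) :
    hammingNorm (∑ k ∈ s, v k) ≤ ∑ k ∈ s, hammingNorm (v k) :=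
  Finset.le_sum_of_subadditive _ hammingNorm_zero.le hammingNorm_add_le s v

theorem hammingNorm_le_of_mem_span_range_sup_supportedOn {κ : Type*} [Fintype κ] {w : ℕ}
    {A : Finset ι} {v : κ → ι → F} (hv : ∀ k, hammingNorm (v k) ≤ w) {x : ι → F}
    (hx : x ∈ span F (Set.range v) ⊔ supportedOn F A) :
    hammingNorm x ≤ Fintype.card κ * w + A.card := by
  obtain ⟨y, hy, a, ha, rfl⟩ := mem_sup.1 hx
  obtain ⟨c, rfl⟩ := (mem_span_range_iff_exists_fun F).1 hy
  calc hammingNorm (∑ k, c k • v k + a)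
      ≤ ∑ k, hammingNorm (c k • v k) + hammingNorm a :=
        (hammingNorm_add_le _ _).trans (Nat.add_le_add_right (hammingNorm_sum_le _ _) _)
    _ ≤ ∑ _k : κ, w + A.card := by
        gcongr with k
        · exact hammingNorm_smul_le_hammingNorm.trans (hv k)
        · exact hammingNorm_le_of_mem_supportedOn ha
    _ = Fintype.card κ * w + A.card := by simp

/-- The Hamming ball of radius `w` around the origin. -/
def hammingBall (F ι : Type*) [Field F] [DecidableEq F] [Fintype ι] (w : ℕ) : Set (ι → F) :=
  {v | hammingNorm v ≤ w}

theorem ncard_hammingBall_pos [Finite F] (w : ℕ) : 0 < (hammingBall F ι w).ncard :=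
  (Set.ncard_pos (Set.toFinite _)).2 ⟨0, hammingNorm_zero.trans_le w.zero_le⟩

theorem card_finset_card_le_le_ncard_hammingBall [Finite F] (w : ℕ) :
    Nat.card {A : Finset ι // A.card ≤ w} ≤ (hammingBall F ι w).ncard := by
  classical
  let indicator (A : {A : Finset ι // A.card ≤ w}) : hammingBall F ι w :=
    ⟨fun i => if i ∈ A.1 then 1 else 0,
      (hammingNorm_le_of_mem_supportedOn fun i hi => if_neg hi).trans A.2⟩
  refine (Nat.card_le_card_of_injective indicator fun A B hAB => ?_).trans_eq
    (Nat.card_coe_set_eq _)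
  ext i
  have h : (if i ∈ A.1 then (1 : F) else 0) = if i ∈ B.1 then 1 else 0 :=
    congrFun (congrArg Subtype.val hAB) i
  by_cases hA : i ∈ A.1 <;> by_cases hB : i ∈ B.1 <;> simp_all

end HammingWeight

section Robustness

open Module Submodule

theorem finrank_sup_inf_le_finrank_inf_sup {F V : Type*} [Field F] [AddCommGroup V]
    [Module F V] [Module.Finite F V] (D : Submodule F V) {E B : Submodule F V}
    (hEB : Disjoint E B) :
    finrank F ↥((D ⊔ B) ⊓ E) ≤ finrank F ↥(D ⊓ (E ⊔ B)) := by
  have hle : (D ⊔ B) ⊓ E ⊔ B ≤ D ⊓ (E ⊔ B) ⊔ B := by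
    refine sup_le (fun x hx => ?_) le_sup_right
    obtain ⟨d, hd, b, hb, rfl⟩ := mem_sup.1 hx.1
    refine add_mem_sup ⟨hd, ?_⟩ hb
    simpa using add_mem_sup hx.2 (neg_mem hb)
  have hdisj : (D ⊔ B) ⊓ E ⊓ B = ⊥ := (hEB.mono_left inf_le_right).eq_bot
  have hsup := finrank_sup_add_finrank_inf_eq ((D ⊔ B) ⊓ E) B
  rw [hdisj, finrank_bot] at hsup
  have := Submodule.finrank_mono hle
  have := finrank_add_le_finrank_add_finrank (D ⊓ (E ⊔ B)) B
  omega

variable {F ι : Type*} [Field F] [DecidableEq F] [Fintype ι]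

/-- A code `D` is `(w, m)`-robust if no nonzero space of dimension at most `m` spanned by vectors of
weight at most `w` meets `D` in half of its dimension or more, even after `D` has been enlarged by
all vectors supported on a set of at most `w` coordinates. -/
def IsRobust (w m : ℕ) (D : Submodule F (ι → F)) : Prop :=
  ∀ A : Finset ι, A.card ≤ w → ∀ S : Set (ι → F), (∀ v ∈ S, hammingNorm v ≤ w) →
    Disjoint (span F S) (supportedOn F A) → 0 < finrank F (span F S) → finrank F (span F S) ≤ m →
      2 * finrank F ↥((D ⊔ supportedOn F A) ⊓ span F S) < finrank F (span F S)

theorem exists_of_not_isRobust {w m : ℕ} {D : Submodule F (ι → F)} (hD : ¬ IsRobust w m D) :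
    ∃ d ∈ Set.Icc 1 m, ∃ A : Finset ι, A.card ≤ w ∧ ∃ v : Fin d → ι → F,
      (∀ i, hammingNorm (v i) ≤ w) ∧
        d ≤ 2 * finrank F ↥(D ⊓ (span F (Set.range v) ⊔ supportedOn F A)) := by
  simp only [IsRobust, not_forall, not_lt] at hD
  obtain ⟨A, hA, S, hS, hdisj, hpos, hle, hmeet⟩ := hD
  obtain ⟨v, hvS, hvspan, -⟩ := exists_fun_fin_finrank_span_eq F S
  refine ⟨_, ⟨hpos, hle⟩, A, hA, v, fun i => hS _ (hvS i), ?_⟩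
  rw [hvspan]
  exact hmeet.trans (Nat.mul_le_mul_left 2 (finrank_sup_inf_le_finrank_inf_sup D hdisj))

variable [Finite F] {Ω : Type*} [MeasurableSpace Ω] {μ : Measure Ω} [IsFiniteMeasure μ]
  {D : Ω → Submodule F (ι → F)} {p : ℝ} {w m d : ℕ}

theorem IsSpread.measureReal_le_two_mul_finrank_inf_span_sup_supportedOn_le (hp : 0 ≤ p)
    (hD : IsSpread μ D 1 p) (hw : 3 * w < Fintype.card ι) (hd : d ≤ m) {A : Finset ι}
    (hA : A.card ≤ w) {v : Fin d → ι → F} (hv : ∀ i, hammingNorm (v i) ≤ w) :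
    μ.real {ω | d ≤ 2 * finrank F ↥(D ω ⊓ (span F (Set.range v) ⊔ supportedOn F A))} ≤
      ((Nat.card F : ℝ) ^ (m + w) * p) ^ ((d + 1) / 2) := by
  have hq : (1 : ℝ) ≤ Nat.card F := by exact_mod_cast Finite.card_pos
  have hdim : finrank F ↥(span F (Set.range v) ⊔ supportedOn F A) ≤ m + w := by
    refine (finrank_add_le_finrank_add_finrank _ _).trans (add_le_add ?_ ?_)
    · exact (finrank_range_le_card v).trans (by simpa using hd)
    · exact (finrank_supportedOn_le A).trans hA
  have hone : 2 ≤ (d + 1) / 2 ∨ (1 : ι → F) ∉ span F (Set.range v) ⊔ supportedOn F A := by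
    refine or_iff_not_imp_right.2 fun h => ?_
    have hweight := hammingNorm_le_of_mem_span_range_sup_supportedOn hv (not_not.1 h)
    rw [Fintype.card_fin, show hammingNorm (1 : ι → F) = Fintype.card ι by simp [hammingNorm]]
      at hweight
    by_contra! hd2
    have : d * w ≤ 2 * w := Nat.mul_le_mul_right w (by omega)
    omega
  calc μ.real {ω | d ≤ 2 * finrank F ↥(D ω ⊓ (span F (Set.range v) ⊔ supportedOn F A))}
      ≤ μ.real {ω | (d + 1) / 2 ≤ finrank F ↥(D ω ⊓ (span F (Set.range v) ⊔ supportedOn F A))} :=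
        measureReal_mono fun ω hω => by
          simp only [Set.mem_ofPred_eq] at hω ⊢
          omega
    _ ≤ _ := hD.measureReal_le_finrank_inf_le hp hone
    _ ≤ ((Nat.card F : ℝ) ^ (m + w) * p) ^ ((d + 1) / 2) := by gcongr

theorem IsSpread.measureReal_not_isRobust_le (hp : 0 ≤ p) (hD : IsSpread μ D 1 p)
    (hw : 3 * w < Fintype.card ι)
    (hβ : ((hammingBall F ι w).ncard : ℝ) ^ 3 * ((Nat.card F : ℝ) ^ (m + w) * p) ≤ 1) :
    μ.real {ω | ¬ IsRobust w m (D ω)} ≤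
      m * (((hammingBall F ι w).ncard : ℝ) ^ 3 * ((Nat.card F : ℝ) ^ (m + w) * p)) := by
  set L : ℝ := ((hammingBall F ι w).ncard : ℝ) with hL
  set γ : ℝ := (Nat.card F : ℝ) ^ (m + w) * p
  have hL1 : 1 ≤ L := Nat.one_le_cast.2 (ncard_hammingBall_pos w)
  have : 0 ≤ γ := by positivity
  let Config (d : ℕ) := {A : Finset ι // A.card ≤ w} × (Fin d → hammingBall F ι w)
  let Meets (d : ℕ) (C : Config d) (ω : Ω) : Prop :=
    d ≤ 2 * finrank F ↥(D ω ⊓ (span F (Set.range fun i => (C.2 i : ι → F)) ⊔ supportedOn F C.1.1))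
  have hconfig (d : ℕ) : (Nat.card (Config d) : ℝ) ≤ L ^ (1 + d) := by
    rw [Nat.card_prod, Nat.card_fun, Nat.card_fin, Nat.card_coe_set_eq, pow_add, pow_one, hL]
    exact_mod_cast Nat.mul_le_mul_right _ (card_finset_card_le_le_ncard_hammingBall w)
  have hdim (d : Set.Icc 1 m) : μ.real {ω | ∃ C, Meets d C ω} ≤ L ^ 3 * γ := by
    obtain ⟨d, hd⟩ := d
    have hd1 : 1 ≤ d := hd.1
    calc μ.real {ω | ∃ C, Meets d C ω}
        ≤ Nat.card (Config d) * γ ^ ((d + 1) / 2) := measureReal_setOf_exists_le fun C =>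
          hD.measureReal_le_two_mul_finrank_inf_span_sup_supportedOn_le hp hw hd.2 C.1.2
            fun i => (C.2 i).2
      _ ≤ L ^ (3 * ((d + 1) / 2)) * γ ^ ((d + 1) / 2) := by
          gcongr
          exact (hconfig d).trans (pow_le_pow_right₀ hL1 (by omega))
      _ = (L ^ 3 * γ) ^ ((d + 1) / 2) := by rw [pow_mul, ← mul_pow]
      _ ≤ L ^ 3 * γ := pow_le_of_le_one (by positivity) hβ (by omega)
  calc μ.real {ω | ¬ IsRobust w m (D ω)}
      ≤ μ.real {ω | ∃ d : Set.Icc 1 m, ∃ C, Meets d C ω} := measureReal_mono fun ω hω => by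
        obtain ⟨d, hd, A, hA, v, hv, hmeet⟩ := exists_of_not_isRobust hω
        exact ⟨⟨d, hd⟩, ⟨⟨A, hA⟩, fun i => ⟨v i, hv i⟩⟩, hmeet⟩
    _ ≤ Nat.card (Set.Icc 1 m) * (L ^ 3 * γ) := measureReal_setOf_exists_le hdim
    _ = m * (L ^ 3 * γ) := by simp

end Robustness

section ResidualRowSpace

open Module Submodule
open scoped Matrix

variable {F ι κ : Type*} [Field F] [Fintype ι]

theorem dualCode_sup (C D : Submodule F (ι → F)) :
    dualCode (C ⊔ D) = dualCode C ⊓ dualCode D := by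
  refine le_antisymm (le_inf ?_ ?_) (le_dualCode_comm.1 (sup_le ?_ ?_))
  · exact dualCode_le_dualCode.2 le_sup_left
  · exact dualCode_le_dualCode.2 le_sup_right
  · exact le_dualCode_comm.1 inf_le_left
  · exact le_dualCode_comm.1 inf_le_right

/-- The span of the combinations of the rows of `y` whose coefficient vectors lie in `C^⊥`. These
combinations annihilate every matrix with columns in `C`, so they only see the part of `y` that is
not explained by `C`. -/
def residualRowSpace (C : Submodule F (ι → F)) (y : Matrix ι κ F) : Submodule F (κ → F) :=
  (dualCode C).map y.vecMulLinear

theorem residualRowSpace_le_of_mem_sup {C : Submodule F (ι → F)} {C₂ : Submodule F (κ → F)}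
    {y : Matrix ι κ F} (hy : y ∈ tensorCode C ⊤ ⊔ tensorCode ⊤ C₂) :
    residualRowSpace C y ≤ C₂ := by
  obtain ⟨c, hc, r, hr, rfl⟩ := mem_sup.1 hy
  rintro _ ⟨x, hx, rfl⟩
  have hxc : x ᵥ* c = 0 := funext fun j => hx _ (hc.1 j)
  rw [Matrix.vecMulLinear_apply, Matrix.vecMul_add, hxc, zero_add, Matrix.vecMul_eq_sum]
  exact sum_mem fun i _ => C₂.smul_mem _ (hr.2 i)

variable [Fintype κ]

theorem ker_vecMulLinear_eq_dualCode (y : Matrix ι κ F) :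
    LinearMap.ker y.vecMulLinear = dualCode (LinearMap.range y.mulVecLin) := by
  ext x
  simp only [LinearMap.mem_ker, Matrix.vecMulLinear_apply, mem_dualCode, LinearMap.mem_range,
    Matrix.mulVecLin_apply, forall_exists_index, forall_apply_eq_imp_iff, Matrix.dotProduct_mulVec,
    dotProduct_eq_zero_iff]

theorem finrank_residualRowSpace_add (C : Submodule F (ι → F)) (y : Matrix ι κ F) :
    finrank F (residualRowSpace C y) + finrank F ↥(C ⊓ LinearMap.range y.mulVecLin) = y.rank := by
  have hmap := LinearMap.finrank_range_add_finrank_ker (y.vecMulLinear.domRestrict (dualCode C))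
  have hker : finrank F ((LinearMap.ker y.vecMulLinear).comap (dualCode C).subtype) =
      finrank F (dualCode (C ⊔ LinearMap.range y.mulVecLin)) := by
    rw [← finrank_map_subtype_eq (dualCode C), map_comap_subtype, ker_vecMulLinear_eq_dualCode,
      dualCode_sup]
  rw [LinearMap.range_domRestrict, LinearMap.ker_domRestrict, hker, finrank_dualCode,
    finrank_dualCode] at hmap
  have hsup := finrank_sup_add_finrank_inf_eq C (LinearMap.range y.mulVecLin)
  have hle := (C ⊔ LinearMap.range y.mulVecLin).finrank_le
  rw [finrank_pi] at hle
  have hCle := Submodule.finrank_mono (le_sup_left : C ≤ C ⊔ LinearMap.range y.mulVecLin)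
  rw [residualRowSpace, Matrix.rank]
  omega

theorem finrank_le_finrank_residualRowSpace_add (C : Submodule F (ι → F)) {y : Matrix ι κ F}
    {U : Submodule F (ι → F)} (hU : U ≤ LinearMap.range y.mulVecLin) :
    finrank F U ≤ finrank F (residualRowSpace C y) + finrank F ↥(C ⊓ U) := by
  have hadd := finrank_sup_add_finrank_inf_eq (C ⊓ LinearMap.range y.mulVecLin) U
  have hsup := Submodule.finrank_mono (sup_le (inf_le_right (a := C)) hU)
  rw [inf_assoc, inf_eq_right.2 hU] at hadd
  have := finrank_residualRowSpace_add C y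
  rw [Matrix.rank] at this
  omega

end ResidualRowSpace

section HighRank

open Module Submodule

variable {Ω₁ Ω₂ : Type*} [MeasurableSpace Ω₁] [MeasurableSpace Ω₂]

theorem measureReal_prod_le_add {μ : Measure Ω₁} {ν : Measure Ω₂} [IsProbabilityMeasure μ]
    [IsProbabilityMeasure ν] {S : Set (Ω₁ × Ω₂)} (hS : MeasurableSet S) {b : ℝ} (hb : 0 ≤ b)
    {G : Set Ω₁} (h : ∀ ω ∉ G, ν.real (Prod.mk ω ⁻¹' S) ≤ b) :
    (μ.prod ν).real S ≤ μ.real G + b := by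
  have hslice (ω : Ω₁) : ν (Prod.mk ω ⁻¹' S) ≤ G.indicator 1 ω + ENNReal.ofReal b := by
    by_cases hω : ω ∈ G
    · simpa [hω] using prob_le_one.trans le_self_add
    · simpa [hω] using (ENNReal.le_ofReal_iff_toReal_le (measure_ne_top _ _) hb).2 (h ω hω)
  refine ENNReal.toReal_le_of_le_ofReal (by positivity) ?_
  calc μ.prod ν S = ∫⁻ ω, ν (Prod.mk ω ⁻¹' S) ∂μ := Measure.prod_apply hS
    _ ≤ ∫⁻ ω, G.indicator 1 ω + ENNReal.ofReal b ∂μ := lintegral_mono hslice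
    _ = ∫⁻ ω, G.indicator 1 ω ∂μ + ENNReal.ofReal b := by
        rw [lintegral_add_right _ measurable_const, lintegral_const, measure_univ, mul_one]
    _ ≤ μ G + ENNReal.ofReal b := by gcongr; exact lintegral_indicator_one_le G
    _ = ENNReal.ofReal (μ.real G + b) := by
        rw [ENNReal.ofReal_add measureReal_nonneg hb, ofReal_measureReal]

theorem IsSpread.measureReal_mem_sup_tensorCode_le {F ι κ : Type*} [Field F] [Finite F] [Finite ι]
    [Fintype κ] [DiscreteMeasurableSpace (Ω₁ × Ω₂)] {μ : Measure Ω₁} {ν : Measure Ω₂}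
    [IsProbabilityMeasure μ] [IsProbabilityMeasure ν] {D₁ : Ω₁ → Submodule F (ι → F)}
    {D₂ : Ω₂ → Submodule F (κ → F)} {u₁ : ι → F} {u₂ : κ → F} {p : ℝ} (hp : 0 ≤ p)
    (hD₁ : IsSpread μ D₁ u₁ p) (hD₂ : IsSpread ν D₂ u₂ p) {t : ℕ} (ht : 2 ≤ t)
    {x : Matrix ι κ F} (hx : 2 * t ≤ x.rank) :
    (μ.prod ν).real {ω | x ∈ tensorCode (D₁ ω.1) ⊤ ⊔ tensorCode ⊤ (D₂ ω.2)} ≤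
      2 * ((Nat.card F : ℝ) ^ (2 * t) * p) ^ t := by
  have := Fintype.ofFinite ι
  obtain ⟨U, hU, hUt⟩ := exists_le_finrank_eq hx
  have hcol : μ.real {ω | t ≤ finrank F ↥(D₁ ω ⊓ U)} ≤ ((Nat.card F : ℝ) ^ (2 * t) * p) ^ t := by
    simpa [hUt] using hD₁.measureReal_le_finrank_inf_le hp (E := U) (Or.inl ht)
  have hrow (ω : Ω₁) (hω : ω ∉ {ω | t ≤ finrank F ↥(D₁ ω ⊓ U)}) :
      ν.real {ω' | x ∈ tensorCode (D₁ ω) ⊤ ⊔ tensorCode ⊤ (D₂ ω')} ≤ p ^ t := by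
    have hresidual : t ≤ finrank F (residualRowSpace (D₁ ω) x) := by
      have := finrank_le_finrank_residualRowSpace_add (D₁ ω) hU
      rw [Set.mem_ofPred_eq] at hω
      omega
    exact (measureReal_mono (s₂ := {ω' | residualRowSpace (D₁ ω) x ≤ D₂ ω'}) fun ω' hω' =>
      residualRowSpace_le_of_mem_sup hω').trans (hD₂.measureReal_le_pow ht hresidual)
  have hpow : p ^ t ≤ ((Nat.card F : ℝ) ^ (2 * t) * p) ^ t := by
    refine pow_le_pow_left₀ hp (le_mul_of_one_le_left hp (one_le_pow₀ ?_)) t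
    exact_mod_cast Finite.card_pos
  have hprod := measureReal_prod_le_add (μ := μ)
    (S := {ω | x ∈ tensorCode (D₁ ω.1) ⊤ ⊔ tensorCode ⊤ (D₂ ω.2)}) .of_discrete
    (pow_nonneg hp t) hrow
  linarith

end HighRank

section Weights

variable {F : Type*} [Field F] {ι κ : Type*}

theorem matrixWeight_transpose (x : Matrix ι κ F) : matrixWeight x.transpose = matrixWeight x := by
  rw [matrixWeight, matrixWeight, ← Set.ncard_image_of_injective _ Prod.swap_injective]
  congr 1
  ext ⟨i, j⟩
  simp

theorem rowWeight_le_card {A : Finset ι} {x : Matrix ι κ F} (h : ∀ i, i ∉ A → ∀ j, x i j = 0) :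
    rowWeight x ≤ A.card := by
  rw [rowWeight, ← Set.ncard_coe_finset]
  refine Set.ncard_le_ncard fun i hi => ?_
  obtain ⟨j, hj⟩ := hi
  by_contra hA
  exact hj (h i hA j)

theorem colWeight_le_card {B : Finset κ} {x : Matrix ι κ F} (h : ∀ j, j ∉ B → ∀ i, x i j = 0) :
    colWeight x ≤ B.card :=
  rowWeight_le_card (x := x.transpose) h

variable [DecidableEq F] [Fintype ι] [Fintype κ]

theorem matrixWeight_eq_sum_hammingNorm (x : Matrix ι κ F) :
    matrixWeight x = ∑ i, hammingNorm (x i) := by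
  classical
  rw [matrixWeight, Set.ncard_eq_toFinset_card', Set.toFinset_ofPred, Finset.card_filter,
    Fintype.sum_prod_type]
  simp only [hammingNorm, Finset.card_filter]

/-- The set of rows of `x` of Hamming weight larger than `w`. -/
def heavyRows (w : ℕ) (x : Matrix ι κ F) : Finset ι :=
  Finset.univ.filter fun i => w < hammingNorm (x i)

theorem hammingNorm_le_of_notMem_heavyRows {w : ℕ} {x : Matrix ι κ F} {i : ι}
    (hi : i ∉ heavyRows w x) : hammingNorm (x i) ≤ w := by
  simpa [heavyRows] using hi

theorem card_heavyRows_mul_le (w : ℕ) (x : Matrix ι κ F) :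
    (heavyRows w x).card * (w + 1) ≤ matrixWeight x := by
  rw [matrixWeight_eq_sum_hammingNorm, ← smul_eq_mul]
  refine (Finset.card_nsmul_le_sum _ _ _ fun i hi => ?_).trans
    (Finset.sum_le_sum_of_subset (Finset.subset_univ (heavyRows w x)))
  exact (Finset.mem_filter.1 hi).2

theorem card_heavyRows_le {w : ℕ} {x : Matrix ι κ F} (hx : matrixWeight x < (w + 1) * (w + 1)) :
    (heavyRows w x).card ≤ w :=
  Nat.lt_succ_iff.1
    (lt_of_mul_lt_mul_right ((card_heavyRows_mul_le w x).trans_lt hx) (Nat.zero_le _))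

end Weights

section CrossSupport

open Module Submodule

variable {F : Type*} [Field F]

theorem exists_isProj_le_ker_of_disjoint {V : Type*} [AddCommGroup V] [Module F V]
    {D E : Submodule F V} (h : Disjoint D E) :
    ∃ f : V →ₗ[F] V, LinearMap.IsProj D f ∧ E ≤ LinearMap.ker f := by
  obtain ⟨D', hED', hcompl⟩ := h.symm.exists_isCompl
  refine ⟨D.subtype ∘ₗ D.projectionOnto D' hcompl.symm, ⟨fun v => by simp, fun v hv => ?_⟩,
    fun v hv => by simp [hED' hv]⟩
  simpa using congrArg Subtype.val (projectionOnto_apply_left hcompl.symm ⟨v, hv⟩)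

variable {ι κ : Type*}

theorem mul_mem_tensorCode_top [Fintype κ] {κ' : Type*} {D : Submodule F (ι → F)}
    {c : Matrix ι κ F} (hc : c ∈ tensorCode D ⊤) (Q : Matrix κ κ' F) :
    c * Q ∈ tensorCode D ⊤ := by
  refine ⟨fun j => ?_, fun _ => mem_top⟩
  have hcol : (fun i => (c * Q) i j) = ∑ k, Q k j • fun i => c i k := by
    ext i
    simp [Matrix.mul_apply, mul_comm]
  rw [hcol]
  exact sum_mem fun k _ => D.smul_mem _ (hc.1 k)

theorem exists_decomposition_of_eq_zero_off_cross [Finite κ] {D₁ : Submodule F (ι → F)}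
    {D₂ : Submodule F (κ → F)} {A : Finset ι} {B : Finset κ} (hA : Disjoint D₁ (supportedOn F A))
    (hB : Disjoint D₂ (supportedOn F B)) {x : Matrix ι κ F}
    (hx : x ∈ tensorCode D₁ ⊤ ⊔ tensorCode ⊤ D₂) (hzero : ∀ i, i ∉ A → ∀ j, j ∉ B → x i j = 0) :
    ∃ c ∈ tensorCode D₁ (⊤ : Submodule F (κ → F)), ∃ r ∈ tensorCode (⊤ : Submodule F (ι → F)) D₂,
      x = c + r ∧ (∀ j, j ∉ B → ∀ i, c i j = 0) ∧ ∀ i, i ∉ A → ∀ j, r i j = 0 := by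
  classical
  have := Fintype.ofFinite κ
  obtain ⟨c, hc, r, hr, rfl⟩ := mem_sup.1 hx
  obtain ⟨f, hfproj, hfB⟩ := exists_isProj_le_ker_of_disjoint hB
  set z : Matrix ι κ F := c * (LinearMap.toMatrix' f).transpose
  have hz_row (i : ι) : z i = f (c i) := by
    rw [← LinearMap.toMatrix'_mulVec, ← Matrix.vecMul_transpose]
    rfl
  have hz : z ∈ tensorCode D₁ ⊤ := mul_mem_tensorCode_top hc _
  have hrow : ∀ i, i ∉ A → ∀ j, (r + z) i j = 0 := by
    intro i hi j
    have hker : f (c i + r i) = 0 := hfB fun j hj => hzero i hi j hj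
    rw [map_add, hfproj.map_id _ (hr.2 i), add_comm, ← hz_row] at hker
    exact congrFun hker j
  have hcol : ∀ j, j ∉ B → ∀ i, (c - z) i j = 0 := by
    intro j hj i
    have hmem : (fun i => (c - z) i j) ∈ D₁ := D₁.sub_mem (hc.1 j) (hz.1 j)
    refine congrFun (disjoint_def.1 hA _ hmem fun i hi => ?_) i
    have hxij := hzero i hi j hj
    have hrzij := hrow i hi j
    simp only [Matrix.add_apply, Matrix.sub_apply] at hxij hrzij ⊢
    linear_combination hxij - hrzij
  refine ⟨c - z, sub_mem hc hz, r + z, ⟨fun _ => mem_top, fun i => ?_⟩, by abel, hcol, hrow⟩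
  exact D₂.add_mem (hr.2 i) (by rw [hz_row]; exact hfproj.map_mem _)

end CrossSupport

section EraseCross

open Submodule

variable {F : Type*} [Field F] {ι κ : Type*} [DecidableEq ι] [DecidableEq κ]

/-- The matrix obtained from `x` by replacing the rows in `A` and the columns in `B` by zero. -/
def eraseCross (A : Finset ι) (B : Finset κ) (x : Matrix ι κ F) : Matrix ι κ F :=
  Matrix.of fun i j => if i ∈ A ∨ j ∈ B then 0 else x i j

variable {A : Finset ι} {B : Finset κ} {x : Matrix ι κ F}

theorem transpose_eraseCross :
    (eraseCross A B x).transpose = eraseCross B A x.transpose := by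
  ext j i
  simp [eraseCross, or_comm]

theorem eraseCross_apply_of_mem_left {i : ι} (hi : i ∈ A) (j : κ) : eraseCross A B x i j = 0 :=
  if_pos (Or.inl hi)

theorem eraseCross_apply_of_mem_right {j : κ} (hj : j ∈ B) (i : ι) : eraseCross A B x i j = 0 :=
  if_pos (Or.inr hj)

theorem eraseCross_apply_of_notMem {i : ι} {j : κ} (hi : i ∉ A) (hj : j ∉ B) :
    eraseCross A B x i j = x i j :=
  if_neg (not_or.2 ⟨hi, hj⟩)

theorem eraseCross_mem_sup_tensorCode {D₁ : Submodule F (ι → F)} {D₂ : Submodule F (κ → F)}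
    (hx : x ∈ tensorCode D₁ ⊤ ⊔ tensorCode ⊤ D₂) :
    eraseCross A B x ∈
      tensorCode (D₁ ⊔ supportedOn F A) ⊤ ⊔ tensorCode ⊤ (D₂ ⊔ supportedOn F B) := by
  obtain ⟨c, hc, r, hr, rfl⟩ := mem_sup.1 hx
  let a : Matrix ι κ F := .of fun i j => if i ∈ A then -(c i j + r i j) else 0
  let b : Matrix ι κ F := .of fun i j => if i ∉ A ∧ j ∈ B then -(c i j + r i j) else 0
  have herase : eraseCross A B (c + r) = (c + a) + (r + b) := by
    ext i j
    by_cases hi : i ∈ A <;> by_cases hj : j ∈ B <;> simp [eraseCross, a, b, hi, hj]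
  rw [herase]
  refine add_mem_sup ⟨fun j => ?_, fun _ => mem_top⟩ ⟨fun _ => mem_top, fun i => ?_⟩
  · exact add_mem_sup (hc.1 j) fun i hi => if_neg hi
  · exact add_mem_sup (hr.2 i) fun j hj => if_neg fun h => hj h.2

variable [Fintype κ]

theorem rank_eraseCross_le [Finite ι] : (eraseCross A B x).rank ≤ x.rank := by
  have := Fintype.ofFinite ι
  have hmul : eraseCross A B x = Matrix.diagonal (fun i => if i ∈ A then (0 : F) else 1) * x *
      Matrix.diagonal (fun j => if j ∈ B then (0 : F) else 1) := by
    ext i j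
    rw [Matrix.mul_diagonal, Matrix.diagonal_mul]
    by_cases hi : i ∈ A <;> by_cases hj : j ∈ B <;> simp [eraseCross, hi, hj]
  rw [hmul]
  exact (Matrix.rank_mul_le_left _ _).trans (Matrix.rank_mul_le_right _ _)

theorem hammingNorm_eraseCross_le [DecidableEq F] [Fintype ι] {w : ℕ} (i : ι) :
    hammingNorm (eraseCross (heavyRows w x) B x i) ≤ w := by
  by_cases hi : i ∈ heavyRows w x
  · have hrow : eraseCross (heavyRows w x) B x i = 0 := funext (eraseCross_apply_of_mem_left hi)
    simp [hrow]
  · refine (Finset.card_le_card fun j hj => ?_).trans (hammingNorm_le_of_notMem_heavyRows hi)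
    simp only [Finset.mem_filter, Finset.mem_univ, true_and] at hj ⊢
    exact fun h => hj (by simp [eraseCross, h])

end EraseCross

section RobustExpansion

open Module Submodule

variable {F ι κ : Type*} [Field F]

theorem eq_zero_of_rank_eq_zero [Fintype κ] {y : Matrix ι κ F} (hy : y.rank = 0) :
    y = 0 := by
  classical
  rwa [Matrix.rank, finrank_eq_zero, LinearMap.range_eq_bot, ← Matrix.toLin'_apply',
    map_eq_zero_iff _ (LinearEquiv.injective _)] at hy

theorem disjoint_span_range_col_supportedOn {A : Finset ι} {x : Matrix ι κ F}
    (hx : ∀ i ∈ A, ∀ j, x i j = 0) : Disjoint (span F (Set.range x.col)) (supportedOn F A) := by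
  refine disjoint_def.2 fun v hv hvA => funext fun i => ?_
  by_cases hi : i ∈ A
  · have hle : span F (Set.range x.col) ≤ LinearMap.ker (LinearMap.proj i) :=
      span_le.2 (Set.range_subset_iff.2 fun j => hx i hi j)
    exact hle hv
  · exact hvA i hi

variable [DecidableEq F] [Fintype ι] {w m : ℕ} {D₁ : Submodule F (ι → F)}

theorem IsRobust.disjoint_supportedOn (hm : 0 < m) (hD : IsRobust w m D₁) {A : Finset ι}
    (hA : A.card ≤ w) : Disjoint D₁ (supportedOn F A) := by
  refine disjoint_def.2 fun v hv hvA => ?_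
  by_contra hv0
  have hdim : finrank F (span F {v}) = 1 := finrank_span_singleton hv0
  have hempty : supportedOn F (∅ : Finset ι) = ⊥ :=
    eq_bot_iff.2 fun x hx => funext fun i => hx i (Finset.notMem_empty i)
  have hmeet := hD ∅ (by simp) {v}
    (by rintro _ rfl; exact (hammingNorm_le_of_mem_supportedOn hvA).trans hA)
    (hempty ▸ disjoint_bot_right) (by omega) (by omega)
  rw [inf_eq_right.2 ((span_singleton_le_iff_mem _ _).2 (le_sup_left (a := D₁) hv))] at hmeet
  omega

variable [Fintype κ] {D₂ : Submodule F (κ → F)}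

theorem eq_zero_of_mem_sup_tensorCode_of_isRobust (h₁ : IsRobust w m D₁) (h₂ : IsRobust w m D₂)
    {A : Finset ι} {B : Finset κ} (hA : A.card ≤ w) (hB : B.card ≤ w) {y : Matrix ι κ F}
    (hy : y ∈ tensorCode (D₁ ⊔ supportedOn F A) ⊤ ⊔ tensorCode ⊤ (D₂ ⊔ supportedOn F B))
    (hrow : ∀ i, hammingNorm (y i) ≤ w) (hcol : ∀ j, hammingNorm (y.transpose j) ≤ w)
    (hyA : ∀ i ∈ A, ∀ j, y i j = 0) (hyB : ∀ j ∈ B, ∀ i, y i j = 0) (hrank : y.rank ≤ m) :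
    y = 0 := by
  by_contra hy0
  have hpos : 0 < y.rank := Nat.pos_of_ne_zero fun h => hy0 (eq_zero_of_rank_eq_zero h)
  have hrank_col : finrank F (span F (Set.range y.col)) = y.rank := by
    rw [← Matrix.range_mulVecLin, Matrix.rank]
  have hrank_row : finrank F (span F (Set.range y.transpose.col)) = y.rank := by
    rw [← Matrix.range_mulVecLin, ← Matrix.rank_transpose, Matrix.rank]
  have hcol_meet := h₁ A hA (Set.range y.col) (Set.forall_mem_range.2 hcol)
    (disjoint_span_range_col_supportedOn hyA) (by omega) (by omega)
  have hrow_meet := h₂ B hB (Set.range y.transpose.col) (Set.forall_mem_range.2 hrow)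
    (disjoint_span_range_col_supportedOn (x := y.transpose) hyB) (by omega) (by omega)
  have hresidual : residualRowSpace (D₁ ⊔ supportedOn F A) y ≤
      (D₂ ⊔ supportedOn F B) ⊓ span F (Set.range y.transpose.col) := by
    refine le_inf (residualRowSpace_le_of_mem_sup hy) ?_
    rw [← Matrix.range_mulVecLin, Matrix.mulVecLin_transpose]
    exact LinearMap.map_le_range
  have hadd := finrank_residualRowSpace_add (D₁ ⊔ supportedOn F A) y
  rw [Matrix.range_mulVecLin] at hadd
  have := Submodule.finrank_mono hresidual
  omega

theorem exists_decomposition_of_isRobust (hm : 0 < m) (h₁ : IsRobust w m D₁)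
    (h₂ : IsRobust w m D₂) {x : Matrix ι κ F} (hx : x ∈ tensorCode D₁ ⊤ ⊔ tensorCode ⊤ D₂)
    (hrank : x.rank ≤ m) (hweight : matrixWeight x < (w + 1) * (w + 1)) :
    ∃ c ∈ tensorCode D₁ (⊤ : Submodule F (κ → F)), ∃ r ∈ tensorCode (⊤ : Submodule F (ι → F)) D₂,
      x = c + r ∧ colWeight c ≤ (heavyRows w x.transpose).card ∧
        rowWeight r ≤ (heavyRows w x).card := by
  classical
  have hA : (heavyRows w x).card ≤ w := card_heavyRows_le hweight
  have hB : (heavyRows w x.transpose).card ≤ w :=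
    card_heavyRows_le (by rwa [matrixWeight_transpose])
  have herase : eraseCross (heavyRows w x) (heavyRows w x.transpose) x = 0 := by
    refine eq_zero_of_mem_sup_tensorCode_of_isRobust h₁ h₂ hA hB (eraseCross_mem_sup_tensorCode hx)
      hammingNorm_eraseCross_le (fun j => ?_) (fun i hi => eraseCross_apply_of_mem_left hi)
      (fun j hj => eraseCross_apply_of_mem_right hj) (rank_eraseCross_le.trans hrank)
    rw [transpose_eraseCross]
    exact hammingNorm_eraseCross_le j
  obtain ⟨c, hc, r, hr, hcr, hc0, hr0⟩ := exists_decomposition_of_eq_zero_off_cross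
    (h₁.disjoint_supportedOn hm hA) (h₂.disjoint_supportedOn hm hB) hx fun i hi j hj => by
      rw [← eraseCross_apply_of_notMem (x := x) hi hj, herase, Matrix.zero_apply]
  exact ⟨c, hc, r, hr, hcr, colWeight_le_card hc0, rowWeight_le_card hr0⟩

theorem isProductExpanding_of_isRobust {n M : ℕ} (hm : 0 < m) {D₁ D₂ : Submodule F (Fin n → F)}
    (h₁ : IsRobust w m D₁) (h₂ : IsRobust w m D₂)
    (hrank : ∀ x ∈ tensorCode D₁ ⊤ ⊔ tensorCode ⊤ D₂, matrixWeight x ≤ M → x.rank ≤ m)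
    (hM : M < (w + 1) * (w + 1)) {ρ : ℝ} (hρ : 0 ≤ ρ) (hρM : ρ * n * (n + n) ≤ M + 1)
    (hρw : ρ * n * 2 ≤ w + 1) : IsProductExpanding ρ D₁ D₂ := by
  intro x hx
  rcases Nat.lt_or_ge M (matrixWeight x) with hxM | hxM
  · obtain ⟨c, hc, r, hr, rfl⟩ := mem_sup.1 hx
    have hcol : colWeight c ≤ n := by
      simpa using colWeight_le_card (B := Finset.univ) (x := c) (by simp)
    have hrow : rowWeight r ≤ n := by
      simpa using rowWeight_le_card (A := Finset.univ) (x := r) (by simp)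
    refine ⟨c, hc, r, hr, rfl, ?_⟩
    calc ρ * n * (colWeight c + rowWeight r) ≤ ρ * n * (n + n) := by gcongr
      _ ≤ M + 1 := hρM
      _ ≤ matrixWeight (c + r) := by exact_mod_cast hxM
  · obtain ⟨c, hc, r, hr, hcr, hcw, hrw⟩ :=
      exists_decomposition_of_isRobust hm h₁ h₂ hx (hrank x hx hxM) (hxM.trans_lt hM)
    have hcol : (colWeight c : ℝ) * (w + 1) ≤ matrixWeight x := by
      rw [← matrixWeight_transpose]
      exact_mod_cast (Nat.mul_le_mul_right _ hcw).trans (card_heavyRows_mul_le w x.transpose)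
    have hrow : (rowWeight r : ℝ) * (w + 1) ≤ matrixWeight x := by
      exact_mod_cast (Nat.mul_le_mul_right _ hrw).trans (card_heavyRows_mul_le w x)
    refine ⟨c, hc, r, hr, hcr, ?_⟩
    calc ρ * n * (colWeight c + rowWeight r)
        = ρ * n * 2 * (colWeight c + rowWeight r) / 2 := by ring
      _ ≤ (w + 1) * (colWeight c + rowWeight r) / 2 := by gcongr
      _ ≤ matrixWeight x := by linarith

end RobustExpansion

section RandomProductExpansion

open Module Submodule

variable {F : Type*} [Field F] [Finite F] [DecidableEq F]

theorem card_matrixWeight_le_le_ncard_hammingBall {ι κ : Type*} [Fintype ι] [Fintype κ] (M : ℕ) :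
    Nat.card {x : Matrix ι κ F // matrixWeight x ≤ M} ≤ (hammingBall F (ι × κ) M).ncard := by
  let uncurry (x : {x : Matrix ι κ F // matrixWeight x ≤ M}) : hammingBall F (ι × κ) M :=
    ⟨fun p => x.1 p.1 p.2, by
      have hx := x.2
      rw [matrixWeight, Set.ncard_eq_toFinset_card', Set.toFinset_ofPred] at hx
      exact hx⟩
  refine (Nat.card_le_card_of_injective uncurry fun x y hxy => ?_).trans_eq
    (Nat.card_coe_set_eq _)
  ext i j
  exact congrFun (congrArg Subtype.val hxy) (i, j)

variable {Ω₁ Ω₂ : Type*} [MeasurableSpace Ω₁] [MeasurableSpace Ω₂]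
  [DiscreteMeasurableSpace (Ω₁ × Ω₂)] {μ : Measure Ω₁} {ν : Measure Ω₂} [IsProbabilityMeasure μ]
  [IsProbabilityMeasure ν]

theorem IsSpread.measureReal_exists_mem_sup_tensorCode_le {ι κ : Type*} [Fintype ι] [Fintype κ]
    {D₁ : Ω₁ → Submodule F (ι → F)} {D₂ : Ω₂ → Submodule F (κ → F)} {u₁ : ι → F} {u₂ : κ → F}
    {p : ℝ} (hp : 0 ≤ p) (hD₁ : IsSpread μ D₁ u₁ p) (hD₂ : IsSpread ν D₂ u₂ p) {t : ℕ}
    (ht : 2 ≤ t) (M : ℕ) :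
    (μ.prod ν).real {ω | ∃ x : Matrix ι κ F, (matrixWeight x ≤ M ∧ 2 * t ≤ x.rank) ∧
        x ∈ tensorCode (D₁ ω.1) ⊤ ⊔ tensorCode ⊤ (D₂ ω.2)} ≤
      (hammingBall F (ι × κ) M).ncard * (2 * ((Nat.card F : ℝ) ^ (2 * t) * p) ^ t) := by
  have hunion := measureReal_setOf_exists_le (μ := μ.prod ν)
    (P := fun (x : {x : Matrix ι κ F // matrixWeight x ≤ M ∧ 2 * t ≤ x.rank}) ω =>
      x.1 ∈ tensorCode (D₁ ω.1) ⊤ ⊔ tensorCode ⊤ (D₂ ω.2))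
    fun x => hD₁.measureReal_mem_sup_tensorCode_le hp hD₂ ht x.2.2
  have hcard : Nat.card {x : Matrix ι κ F // matrixWeight x ≤ M ∧ 2 * t ≤ x.rank} ≤
      (hammingBall F (ι × κ) M).ncard :=
    (Nat.card_le_card_of_injective _ (Subtype.impEmbedding _ _ fun _ h => h.1).injective).trans
      (card_matrixWeight_le_le_ncard_hammingBall M)
  simp only [Subtype.exists, exists_prop] at hunion
  exact hunion.trans (by gcongr)

theorem IsSpread.measureReal_not_isProductExpanding_le {n : ℕ}
    {D₁ : Ω₁ → Submodule F (Fin n → F)} {D₂ : Ω₂ → Submodule F (Fin n → F)} {p : ℝ} (hp : 0 ≤ p)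
    (hD₁ : IsSpread μ D₁ 1 p) (hD₂ : IsSpread ν D₂ 1 p) {t w M : ℕ} (ht : 2 ≤ t) (hw : 3 * w < n)
    (hβ : ((hammingBall F (Fin n) w).ncard : ℝ) ^ 3 * ((Nat.card F : ℝ) ^ (2 * t + w) * p) ≤ 1)
    (hM : M < (w + 1) * (w + 1)) {ρ : ℝ} (hρ : 0 ≤ ρ) (hρM : ρ * n * (n + n) ≤ M + 1)
    (hρw : ρ * n * 2 ≤ w + 1) :
    (μ.prod ν).real {ω | ¬ IsProductExpanding ρ (D₁ ω.1) (D₂ ω.2)} ≤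
      2 * ((2 * t : ℕ) * (((hammingBall F (Fin n) w).ncard : ℝ) ^ 3 *
        ((Nat.card F : ℝ) ^ (2 * t + w) * p))) +
      (hammingBall F (Fin n × Fin n) M).ncard * (2 * ((Nat.card F : ℝ) ^ (2 * t) * p) ^ t) := by
  have hcover : {ω : Ω₁ × Ω₂ | ¬ IsProductExpanding ρ (D₁ ω.1) (D₂ ω.2)} ⊆
      ({ω | ¬ IsRobust w (2 * t) (D₁ ω)} ×ˢ Set.univ ∪
        Set.univ ×ˢ {ω | ¬ IsRobust w (2 * t) (D₂ ω)}) ∪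
      {ω | ∃ x : Matrix (Fin n) (Fin n) F, (matrixWeight x ≤ M ∧ 2 * t ≤ x.rank) ∧
        x ∈ tensorCode (D₁ ω.1) ⊤ ⊔ tensorCode ⊤ (D₂ ω.2)} := by
    intro ω hω
    by_contra hgood
    simp only [Set.mem_union, Set.mem_prod, Set.mem_univ, and_true, true_and, Set.mem_ofPred_eq,
      not_or, not_not, not_exists, not_and, and_imp] at hgood
    obtain ⟨⟨h₁, h₂⟩, hrank⟩ := hgood
    refine hω (isProductExpanding_of_isRobust (by omega) h₁ h₂ (fun x hx hxM => ?_) hM hρ hρM hρw)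
    by_contra! hlt
    exact hrank x hxM hlt.le hx
  have hw' : 3 * w < Fintype.card (Fin n) := by rwa [Fintype.card_fin]
  refine (measureReal_mono hcover).trans ((measureReal_union_le _ _).trans (add_le_add ?_
    (hD₁.measureReal_exists_mem_sup_tensorCode_le hp hD₂ ht M)))
  refine (measureReal_union_le _ _).trans ?_
  rw [measureReal_prod_prod, measureReal_prod_prod, probReal_univ, probReal_univ, mul_one, one_mul,
    two_mul ((2 * t : ℕ) * _ : ℝ)]
  exact add_le_add (hD₁.measureReal_not_isRobust_le hp hw' hβ)
    (hD₂.measureReal_not_isRobust_le hp hw' hβ)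

end RandomProductExpansion

section HammingBallVolume

variable (F : Type*) [Field F] [DecidableEq F]

theorem sum_pow_hammingNorm [Fintype F] (ι : Type*) [Fintype ι] [DecidableEq ι] (z : ℝ) :
    ∑ v : ι → F, z ^ hammingNorm v = (1 + (Nat.card F - 1) * z) ^ Fintype.card ι := by
  have hcoord : ∑ a : F, (if a = 0 then 1 else z) = 1 + (Nat.card F - 1) * z := by
    rw [← Finset.add_sum_erase _ _ (Finset.mem_univ (0 : F)), if_pos rfl,
      Finset.sum_congr rfl (g := fun _ => z) fun a ha => if_neg (Finset.ne_of_mem_erase ha),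
      Finset.sum_const, Finset.card_erase_of_mem (Finset.mem_univ _), Finset.card_univ,
      nsmul_eq_mul, Nat.cast_pred Fintype.card_pos, Nat.card_eq_fintype_card]
  have hprod (v : ι → F) : ∏ i, (if v i = 0 then 1 else z) = z ^ hammingNorm v := by
    rw [Finset.prod_ite, Finset.prod_const_one, one_mul, Finset.prod_const]
    rfl
  rw [← hcoord, ← Finset.card_univ, ← Finset.prod_const, Finset.prod_univ_sum]
  simp only [hprod, Fintype.piFinset_univ]

variable [Finite F]

theorem ncard_hammingBall_mul_pow_le (ι : Type*) [Fintype ι] {z : ℝ} (hz : 0 ≤ z) (hz1 : z ≤ 1)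
    (w : ℕ) :
    (hammingBall F ι w).ncard * z ^ w ≤ (1 + (Nat.card F - 1) * z) ^ Fintype.card ι := by
  classical
  have := Fintype.ofFinite F
  calc ((hammingBall F ι w).ncard : ℝ) * z ^ w
      = ∑ v : ι → F with hammingNorm v ≤ w, z ^ w := by
        rw [Finset.sum_const, nsmul_eq_mul, hammingBall, Set.ncard_eq_toFinset_card',
          Set.toFinset_ofPred]
    _ ≤ ∑ v : ι → F with hammingNorm v ≤ w, z ^ hammingNorm v :=
        Finset.sum_le_sum fun v hv => pow_le_pow_of_le_one hz hz1 (Finset.mem_filter.1 hv).2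
    _ ≤ ∑ v : ι → F, z ^ hammingNorm v :=
        Finset.sum_le_sum_of_subset_of_nonneg (Finset.subset_univ _) fun _ _ _ => by positivity
    _ = (1 + (Nat.card F - 1) * z) ^ Fintype.card ι := sum_pow_hammingNorm F ι z

theorem exists_ncard_hammingBall_le_pow {B : ℝ} (hB : 1 < B) :
    ∃ α : ℝ, 0 < α ∧ ∀ (ι : Type*) [Fintype ι] (w : ℕ), w ≤ α * Fintype.card ι →
      ((hammingBall F ι w).ncard : ℝ) ≤ B ^ Fintype.card ι := by
  have hq : (1 : ℝ) < Nat.card F := by exact_mod_cast Finite.one_lt_card (α := F)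
  set b := √B
  have hb : 1 < b := Real.lt_sqrt_of_sq_lt (by simpa using hB)
  set z := (b - 1) / (b - 1 + (Nat.card F - 1))
  have hz0 : 0 < z := div_pos (by linarith) (by linarith)
  have hz1 : z < 1 := (div_lt_one (by linarith)).2 (by linarith)
  have hzb : 1 + (Nat.card F - 1) * z ≤ b := by
    have : z * (b - 1 + (Nat.card F - 1)) = b - 1 := div_mul_cancel₀ _ (by linarith)
    nlinarith
  have hlogz : 0 < -Real.log z := neg_pos.2 (Real.log_neg hz0 hz1)
  refine ⟨Real.log b / -Real.log z, div_pos (Real.log_pos hb) hlogz, fun ι _ w hw => ?_⟩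
  set N := Fintype.card ι
  have hbz : 1 ≤ b ^ N * z ^ w := by
    rw [div_mul_eq_mul_div, le_div_iff₀ hlogz] at hw
    rw [← Real.log_nonneg_iff (by positivity), Real.log_mul (by positivity) (by positivity),
      Real.log_pow, Real.log_pow]
    linarith
  calc ((hammingBall F ι w).ncard : ℝ)
      ≤ (hammingBall F ι w).ncard * (b ^ N * z ^ w) := le_mul_of_one_le_right (by positivity) hbz
    _ = b ^ N * ((hammingBall F ι w).ncard * z ^ w) := by ring
    _ ≤ b ^ N * b ^ N := by
        gcongr
        exact (ncard_hammingBall_mul_pow_le F ι hz0.le hz1.le w).trans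
          (pow_le_pow_left₀ (by nlinarith) hzb N)
    _ = B ^ N := by rw [← mul_pow, Real.mul_self_sqrt (by linarith)]

end HammingBallVolume

section Asymptotics

theorem exists_ncard_hammingBall_pow_three_mul_le (F : Type*) [Field F] [Finite F] [DecidableEq F]
    {σ : ℝ} (hσ : 0 < σ) :
    ∃ α : ℝ, 0 < α ∧ ∀ n t w : ℕ, t ≤ σ / 8 * n → w ≤ α * n →
      ((hammingBall F (Fin n) w).ncard : ℝ) ^ 3 *
        ((Nat.card F : ℝ) ^ (2 * t + w) * (Nat.card F : ℝ) ^ (-(σ * n))) ≤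
          ((Nat.card F : ℝ) ^ (-(σ / 2))) ^ n := by
  have hq : (1 : ℝ) < Nat.card F := by exact_mod_cast Finite.one_lt_card (α := F)
  set q := ((Nat.card F : ℕ) : ℝ)
  have hq0 : 0 < q := by linarith
  obtain ⟨α, hα, hball⟩ :=
    exists_ncard_hammingBall_le_pow F (Real.one_lt_rpow hq (by positivity : 0 < σ / 24))
  refine ⟨min α (σ / 8), by positivity, fun n t w ht hw => ?_⟩
  have hwα : (w : ℝ) ≤ α * n := hw.trans (by gcongr; exact min_le_left _ _)
  have hwσ : (w : ℝ) ≤ σ / 8 * n := hw.trans (by gcongr; exact min_le_right _ _)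
  have hvol : ((hammingBall F (Fin n) w).ncard : ℝ) ≤ (q ^ (σ / 24)) ^ n := by
    simpa using hball (Fin n) w (by rwa [Fintype.card_fin])
  calc ((hammingBall F (Fin n) w).ncard : ℝ) ^ 3 * (q ^ (2 * t + w) * q ^ (-(σ * n)))
      ≤ ((q ^ (σ / 24)) ^ n) ^ 3 * (q ^ (2 * t + w) * q ^ (-(σ * n))) := by gcongr
    _ = q ^ (σ / 8 * n + (2 * t + w) - σ * n) := by
        rw [← Real.rpow_mul_natCast hq0.le, ← Real.rpow_mul_natCast hq0.le,
          ← Real.rpow_natCast q (2 * t + w), ← Real.rpow_add hq0, ← Real.rpow_add hq0]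
        congr 1
        push_cast
        ring
    _ ≤ q ^ (-(σ / 2) * n) := Real.rpow_le_rpow_of_exponent_le hq.le (by linarith)
    _ = (q ^ (-(σ / 2))) ^ n := Real.rpow_mul_natCast hq0.le _ _

theorem exists_ncard_hammingBall_mul_pow_le (F : Type*) [Field F] [Finite F] [DecidableEq F]
    {σ : ℝ} (hσ : 0 < σ) :
    ∃ η : ℝ, 0 < η ∧ ∀ n t M : ℕ, σ / 16 * n ≤ t → t ≤ σ / 8 * n → M ≤ η * (n * n) →
      ((hammingBall F (Fin n × Fin n) M).ncard : ℝ) *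
        (2 * ((Nat.card F : ℝ) ^ (2 * t) * (Nat.card F : ℝ) ^ (-(σ * n))) ^ t) ≤
          2 * ((Nat.card F : ℝ) ^ (-(σ ^ 2 / 32))) ^ n := by
  have hq : (1 : ℝ) < Nat.card F := by exact_mod_cast Finite.one_lt_card (α := F)
  set q := ((Nat.card F : ℕ) : ℝ)
  have hq0 : 0 < q := by linarith
  obtain ⟨η, hη, hball⟩ :=
    exists_ncard_hammingBall_le_pow F (Real.one_lt_rpow hq (by positivity : 0 < σ ^ 2 / 64))
  refine ⟨η, hη, fun n t M ht ht' hM => ?_⟩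
  have hvol : ((hammingBall F (Fin n × Fin n) M).ncard : ℝ) ≤ (q ^ (σ ^ 2 / 64)) ^ (n * n) := by
    simpa using hball (Fin n × Fin n) M (by simpa using hM)
  have hbase : q ^ (2 * t) * q ^ (-(σ * n)) ≤ q ^ (-(3 / 4 * σ * n)) := by
    rw [← Real.rpow_natCast q, ← Real.rpow_add hq0]
    refine Real.rpow_le_rpow_of_exponent_le hq.le ?_
    push_cast
    linarith
  have hnn : (n : ℝ) ≤ n * n := by exact_mod_cast Nat.le_mul_self n
  have hexp : σ ^ 2 / 64 * (n * n) + -(3 / 4 * σ * n) * t ≤ -(σ ^ 2 / 32) * n := by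
    have := mul_le_mul_of_nonneg_left ht (by positivity : 0 ≤ 3 / 4 * σ * n)
    have := mul_le_mul_of_nonneg_left hnn (by positivity : 0 ≤ σ ^ 2 / 32)
    linarith
  calc ((hammingBall F (Fin n × Fin n) M).ncard : ℝ) * (2 * (q ^ (2 * t) * q ^ (-(σ * n))) ^ t)
      ≤ (q ^ (σ ^ 2 / 64)) ^ (n * n) * (2 * (q ^ (-(3 / 4 * σ * n))) ^ t) := by gcongr
    _ = 2 * q ^ (σ ^ 2 / 64 * (n * n) + -(3 / 4 * σ * n) * t) := by
        rw [← Real.rpow_mul_natCast hq0.le, ← Real.rpow_mul_natCast hq0.le, mul_left_comm,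
          ← Real.rpow_add hq0, Nat.cast_mul]
    _ ≤ 2 * q ^ (-(σ ^ 2 / 32) * n) := by gcongr; exact hq.le
    _ = 2 * (q ^ (-(σ ^ 2 / 32))) ^ n := by rw [Real.rpow_mul_natCast hq0.le]

theorem tendsto_mul_natCast_mul_pow_add_mul_pow {r s : ℝ} (hr : 0 ≤ r) (hr1 : r < 1) (hs : 0 ≤ s)
    (hs1 : s < 1) (a b : ℝ) :
    Tendsto (fun n : ℕ => a * (n * r ^ n) + b * s ^ n) atTop (𝓝 0) := by
  simpa using ((tendsto_self_mul_const_pow_of_lt_one hr hr1).const_mul a).add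
    ((tendsto_pow_atTop_nhds_zero_of_lt_one hs hs1).const_mul b)

theorem exists_expansion_thresholds {α₀ η₀ : ℝ} (hα₀ : 0 < α₀) (hη₀ : 0 < η₀) :
    ∃ ρ : ℝ, 0 < ρ ∧ ∀ n : ℕ, 0 < n → ∃ w M : ℕ, w ≤ α₀ * n ∧ M ≤ η₀ * (n * n) ∧ 3 * w < n ∧
      M < (w + 1) * (w + 1) ∧ ρ * n * (n + n) ≤ M + 1 ∧ ρ * n * 2 ≤ w + 1 := by
  set α := min α₀ (1 / 4)
  set η := min η₀ (α * α)
  have : 0 < α := by positivity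
  have : 0 < η := by positivity
  refine ⟨min η α / 2, by positivity, fun n hn => ?_⟩
  have hn' : (0 : ℝ) < n := by exact_mod_cast hn
  obtain ⟨w, hwl, hwu⟩ : ∃ w : ℕ, α * n < w + 1 ∧ w ≤ α * n :=
    ⟨_, Nat.lt_floor_add_one _, Nat.floor_le (by positivity)⟩
  obtain ⟨M, hMl, hMu⟩ : ∃ M : ℕ, η * (n * n) < M + 1 ∧ M ≤ η * (n * n) :=
    ⟨_, Nat.lt_floor_add_one _, Nat.floor_le (by positivity)⟩
  have hw : 3 * (w : ℝ) < n := by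
    have : α * n ≤ 1 / 4 * n := by gcongr; exact min_le_right _ _
    linarith
  have hM : (M : ℝ) < (w + 1) * (w + 1) := calc
    (M : ℝ) ≤ η * (n * n) := hMu
    _ ≤ α * α * (n * n) := by gcongr; exact min_le_right _ _
    _ = α * n * (α * n) := by ring
    _ < (w + 1) * (w + 1) := mul_self_lt_mul_self (by positivity) hwl
  refine ⟨w, M, hwu.trans (by gcongr; exact min_le_left _ _),
    hMu.trans (by gcongr; exact min_le_left _ _), by exact_mod_cast hw, by exact_mod_cast hM,
    ?_, ?_⟩
  · calc min η α / 2 * n * (n + n) = min η α * (n * n) := by ring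
      _ ≤ η * (n * n) := by gcongr; exact min_le_left _ _
      _ ≤ M + 1 := hMl.le
  · calc min η α / 2 * n * 2 = min η α * n := by ring
      _ ≤ α * n := by gcongr; exact min_le_right _ _
      _ ≤ w + 1 := hwl.le

theorem exists_measureReal_not_isProductExpanding_le (F : Type*) [Field F] [Finite F] {σ : ℝ}
    (hσ : 0 < σ) :
    ∃ ρ : ℝ, 0 < ρ ∧ ∃ δ : ℕ → ℝ, Tendsto δ atTop (𝓝 0) ∧ ∀ᶠ n in atTop,
      ∀ (Ω₁ Ω₂ : Type*) [MeasurableSpace Ω₁] [MeasurableSpace Ω₂]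
        [DiscreteMeasurableSpace (Ω₁ × Ω₂)] (μ : Measure Ω₁) (ν : Measure Ω₂)
        [IsProbabilityMeasure μ] [IsProbabilityMeasure ν] (D₁ : Ω₁ → Submodule F (Fin n → F))
        (D₂ : Ω₂ → Submodule F (Fin n → F)),
        IsSpread μ D₁ 1 ((Nat.card F : ℝ) ^ (-(σ * n))) →
        IsSpread ν D₂ 1 ((Nat.card F : ℝ) ^ (-(σ * n))) →
          (μ.prod ν).real {ω | ¬ IsProductExpanding ρ (D₁ ω.1) (D₂ ω.2)} ≤ δ n := by
  classical
  have hq : (1 : ℝ) < Nat.card F := by exact_mod_cast Finite.one_lt_card (α := F)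
  obtain ⟨α, hα, hrobust⟩ := exists_ncard_hammingBall_pow_three_mul_le F hσ
  obtain ⟨η, hη, htensor⟩ := exists_ncard_hammingBall_mul_pow_le F hσ
  obtain ⟨ρ, hρ, hthresholds⟩ := exists_expansion_thresholds hα hη
  set q := ((Nat.card F : ℕ) : ℝ)
  have hr : q ^ (-(σ / 2)) < 1 := Real.rpow_lt_one_of_one_lt_of_neg hq (by linarith)
  have hs : q ^ (-(σ ^ 2 / 32)) < 1 :=
    Real.rpow_lt_one_of_one_lt_of_neg hq (neg_lt_zero.2 (by positivity))
  refine ⟨ρ, hρ, _, tendsto_mul_natCast_mul_pow_add_mul_pow (by positivity) hr (by positivity) hs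
    (σ / 2) 2, ?_⟩
  filter_upwards [(tendsto_natCast_atTop_atTop.const_mul_atTop hσ).eventually_ge_atTop 16,
    eventually_gt_atTop 0] with n hσn hn Ω₁ Ω₂ _ _ _ μ ν _ _ D₁ D₂ hD₁ hD₂
  obtain ⟨w, M, hwα, hMη, hw, hM, hρM, hρw⟩ := hthresholds n hn
  obtain ⟨t, htl, htu⟩ : ∃ t : ℕ, σ / 8 * n - 1 < t ∧ t ≤ σ / 8 * n :=
    ⟨_, Nat.sub_one_lt_floor _, Nat.floor_le (by positivity)⟩
  have ht : 1 < t := by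
    have : (1 : ℝ) < t := by linarith
    exact_mod_cast this
  have hβ := hrobust n t w htu hwα
  refine (hD₁.measureReal_not_isProductExpanding_le (by positivity) hD₂ ht hw
    (hβ.trans (pow_le_one₀ (by positivity) hr.le)) hM hρ.le hρM hρw).trans
    (add_le_add ?_ (htensor n t M (by linarith) htu hMη))
  calc 2 * (((2 * t : ℕ) : ℝ) * _) ≤ 2 * ((2 * (σ / 8 * n)) * (q ^ (-(σ / 2))) ^ n) := by
        push_cast
        gcongr
    _ = σ / 2 * (n * (q ^ (-(σ / 2))) ^ n) := by ring

end Asymptotics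

section PlantedCodes

theorem one_sub_add_le_measureReal_and {Ω : Type*} [MeasurableSpace Ω] {μ : Measure Ω}
    [IsProbabilityMeasure μ] {P Q : Ω → Prop} {a b : ℝ} (hP : μ.real {ω | ¬ P ω} ≤ a)
    (hQ : μ.real {ω | ¬ Q ω} ≤ b) : 1 - (a + b) ≤ μ.real {ω | P ω ∧ Q ω} := by
  have hcover : Set.univ ⊆ {ω | P ω ∧ Q ω} ∪ ({ω | ¬ P ω} ∪ {ω | ¬ Q ω}) := fun ω _ => by
    simp only [Set.mem_union, Set.mem_ofPred_eq]
    tauto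
  have hunion := (measureReal_mono (μ := μ) hcover).trans ((measureReal_union_le _ _).trans
    (add_le_add_right (measureReal_union_le _ _) _))
  rw [probReal_univ] at hunion
  linarith

variable (F : Type*) [Field F] [Finite F] {ε : ℝ} {n k : ℕ}

theorem isProbabilityMeasure_uniformOn_plantedCodes (hk : 0 < k) (hkn : k ≤ n) :
    IsProbabilityMeasure (uniformOn (plantedCodes F n k)) :=
  isProbabilityMeasure_uniformOn (Set.toFinite _) (plantedCodes_nonempty hk hkn)

theorem isSpread_plantedCodes_of_lt (hk : k < (1 - ε) * n) (hkn : k ≤ n) :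
    IsSpread (uniformOn (plantedCodes F n k)) id 1 ((Nat.card F : ℝ) ^ (-(ε / 2 * n))) := by
  refine (isSpread_plantedCodes hkn).mono (by positivity)
    (Real.rpow_le_rpow_of_exponent_le ?_ (by linarith))
  exact_mod_cast Finite.card_pos

theorem isSpread_dualCode_plantedCodes_of_lt (hεn : 2 ≤ ε * n) (hk : ε * n < k) (hkn : k ≤ n) :
    IsSpread (uniformOn (plantedCodes F n k)) dualCode 1 ((Nat.card F : ℝ) ^ (-(ε / 2 * n))) := by
  have hk0 : 0 < k := by
    have : (0 : ℝ) < k := by linarith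
    exact_mod_cast this
  refine (isSpread_dualCode_plantedCodes hk0 hkn).mono (by positivity)
    (Real.rpow_le_rpow_of_exponent_le ?_ (by linarith))
  exact_mod_cast Finite.card_pos

end PlantedCodes

theorem mainTheorem5 {F : Type*} [Field F] [Fintype F] (ε : ℝ) (hε : 0 < ε) :
    ∃ ρ : ℝ, 0 < ρ ∧ ∃ δ : ℕ → ℝ, Tendsto δ atTop (𝓝 0) ∧
      ∀ n k₁ k₂ : ℕ,
        ε * n < k₁ → (k₁ : ℝ) < (1 - ε) * n →
        ε * n < k₂ → (k₂ : ℝ) < (1 - ε) * n →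
        1 - δ n ≤
          ((uniformOn (plantedCodes F n k₁)).prod (uniformOn (plantedCodes F n k₂))).real
            {C | IsProductExpanding ρ C.1 (dualCode C.2) ∧
              IsProductExpanding ρ (dualCode C.1) C.2} := by
  obtain ⟨ρ, hρ, δ, hδ, hexpanding⟩ :=
    exists_measureReal_not_isProductExpanding_le F (half_pos hε)
  obtain ⟨N, hN⟩ := eventually_atTop.1 (hexpanding.and
    ((tendsto_natCast_atTop_atTop.const_mul_atTop hε).eventually_ge_atTop 2))
  have hδN : Tendsto (fun n => if N ≤ n then δ n + δ n else 1) atTop (𝓝 0) := by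
    simpa using (hδ.add hδ).congr' ((eventually_ge_atTop N).mono fun n hn => (if_pos hn).symm)
  refine ⟨ρ, hρ, _, hδN, fun n k₁ k₂ hk₁ hk₁' hk₂ hk₂' => ?_⟩
  split_ifs with hn
  · obtain ⟨hexpanding, hεn⟩ := hN n hn
    have hrange {k : ℕ} (hk : ε * n < k) (hk' : k < (1 - ε) * n) : 0 < k ∧ k ≤ n :=
      ⟨Nat.cast_pos.1 (by linarith : (0 : ℝ) < k), Nat.cast_le.1 (by linarith : (k : ℝ) ≤ n)⟩
    obtain ⟨hpos₁, hle₁⟩ := hrange hk₁ hk₁'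
    obtain ⟨hpos₂, hle₂⟩ := hrange hk₂ hk₂'
    have := isProbabilityMeasure_uniformOn_plantedCodes F hpos₁ hle₁
    have := isProbabilityMeasure_uniformOn_plantedCodes F hpos₂ hle₂
    have hcode_dual := hexpanding _ _ _ _ id dualCode (isSpread_plantedCodes_of_lt F hk₁' hle₁)
      (isSpread_dualCode_plantedCodes_of_lt F hεn hk₂ hle₂)
    have hdual_code := hexpanding _ _ _ _ dualCode id
      (isSpread_dualCode_plantedCodes_of_lt F hεn hk₁ hle₁)
      (isSpread_plantedCodes_of_lt F hk₂' hle₂)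
    exact one_sub_add_le_measureReal_and hcode_dual hdual_code
  · rw [sub_self]
    exact measureReal_nonneg
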